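/- **Setting.** Say that $f$ *generates a full shift* if there are countably many (possibly finitely many) pairwise disjoint non-degenerate intervals $J\subset[0,1)$ (the *pieces*; each of the form $[a,b)$, $(a,b]$ or $(a,b)$) with $\sum_J |J|=1$, such that on each piece $f$ is defined, monotone (increasing or decreasing), satisfies $|f(x)-f(y)|\ge|x-y|$ for $x,y\in J$, and $(0,1)\subset f(J)\subset[0,1)$. For a sequence $\omega=(\omega_1,\omega_2,\dots)$ of pieces, the *cylinder of generation $n$* is $C_{\omega_1\dots\omega_n}=\{x\in[0,1): f^{i-1}(x)\in \omega_i,\ 1\le i\le n\}$. A point $x\in[0,1)$ has a *well-defined expansion* $(\omega_i)_{i\ge1}$ if $f^{i-1}(x)\in\omega_i$ for all $i\ge1$. In the *$(\alpha,\beta)$-game* ($\alpha,\beta\in(0,1)$) Black chooses a closed interval $B_0$, and then, alternately for $k\geq 0$, White chooses a closed interval $W_k\subset B_k$ with $|W_k|=\alpha|B_k|$, and Black a closed interval $B_{k+1}\subset W_k$ with $|B_{k+1}|=\beta|W_k|$. For $\alpha_0\in(0,1)$ call $f$ *$\alpha_0$-admissible* if it generates a full shift and (i) for each $k\in\mathbb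 N$, each closed interval $I\subset[0,1)$ and each $\beta\in(0,1)$, White has a strategy in the $(\alpha_0,\beta)$-game started with $B_0=I$ which guarantees that, for some $j$, the interval $W_j$ is contained in a cylinder of generation $k$; (ii) there is $g\colon\mathbb N\to[0,\infty)$ with $g(m)\to0$ such that $|C_{\omega_1\dots\omega_{n+m}}|/|C_{\omega_1\dots\omega_n}|\le g(m)$ for all sequences $\omega$ of pieces and all $n,m\ge1$. For $x$ with a well-defined expansion let $G_f(x)$ be the set of all $y\in[0,1)$ with a well-defined expansion such that $x\notin\overline{\{f^n(y):n\ge0\}}$, and let $G^{\Sigma}_f(x)$ be the set of all $y\in [0,1)$ with a well-defined expansion $(\upsilon_i)$ such that for some $n\geq 1$ the word $\omega_1\dots\omega_n$ starting the expansion of $x$ does not occur in $(\upsilon_i)$. **Statement.** Let $\alpha_0\in(0,1)$, let $(f_i)_{i=1}^\infty$ be a sequence of $\alpha_0$-admissible maps, and let $x_i\in[0,1)$ have a well-defined expansion with respect to $f_i$, for each $i$. Then $$\dim_H\Big(\bigcap_{i=1}^\infty G^{\Sigma}_{f_i}(x_i)\Big)=1 .$$ If moreover, for every $i$ and $n$,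 some neighbourhood of $x_i$ in $[0,1)$ is covered by finitely many generation $n$ cylinders of $f_i$, then $$\dim_H\Big(\bigcap_{i=1}^\infty G_{f_i}(x_i)\Big)=1 .$$ For every $\alpha_0\in(0,\frac12]$ the maps $x\mapsto bx \bmod 1$ (integers $b\ge2$, with pieces $[\frac jb,\frac{j+1}b)$, $0\le j<b$) and the Gauss map $x\mapsto \frac1x \bmod 1$ (with pieces $(\frac1{n+1},\frac1n]\cap[0,1)$, $n\ge1$) are $\alpha_0$-admissible. -/

import Mathlib

open Set Filter Topology MeasureTheory

namespace FullShift

/-- `f` generates a full shift with family of pieces `P`: countably many pairwise disjoint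
nondegenerate intervals in `[0,1)` of total length one, on each of which `f` is monotone
(increasing or decreasing), expands distances weakly and is onto `[0,1)`.
The pieces may be of the form `[a,b)`, `(a,b]` or `(a,b)`, and an image may miss the point `0`
(both are needed for decreasing branches, as in the Gauss map). Values of `f` off the pieces
are never used. -/
structure IsFullShiftMap (f : ℝ → ℝ) (P : Set (Set ℝ)) : Prop where
  countable : P.Countable
  disjoint : P.PairwiseDisjoint id
  interval : ∀ J ∈ P, J ⊆ Ico 0 1 ∧ ∃ a b : ℝ, a < b ∧ Ioo a b ⊆ J ∧ J ⊆ Icc a b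
  total : ∑' J : P, volume (J : Set ℝ) = 1
  monotone : ∀ J ∈ P, MonotoneOn f J ∨ AntitoneOn f J
  onto : ∀ J ∈ P, Ioo 0 1 ⊆ f '' J ∧ f '' J ⊆ Ico 0 1
  expanding : ∀ J ∈ P, ∀ x ∈ J, ∀ y ∈ J, |x - y| ≤ |f x - f y|

/-- The cylinder of generation `n` given by the first `n` symbols of `ω`
(symbols are pieces, indexed from `0`). -/
def cylinder (f : ℝ → ℝ) (ω : ℕ → Set ℝ) (n : ℕ) : Set ℝ :=
  {x | x ∈ Ico (0 : ℝ) 1 ∧ ∀ i < n, f^[i] x ∈ ω i}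

/-- `C` is a cylinder of generation `n`. -/
def IsCylinder (f : ℝ → ℝ) (P : Set (Set ℝ)) (n : ℕ) (C : Set ℝ) : Prop :=
  ∃ ω : ℕ → Set ℝ, (∀ i, ω i ∈ P) ∧ C = cylinder f ω n

/-- `ω` is the expansion of the point `x`. -/
def IsExpansion (f : ℝ → ℝ) (P : Set (Set ℝ)) (x : ℝ) (ω : ℕ → Set ℝ) : Prop :=
  x ∈ Ico (0 : ℝ) 1 ∧ ∀ i, ω i ∈ P ∧ f^[i] x ∈ ω i

/-- `x` is a point of `[0,1)` with a well-defined expansion. -/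
def HasExpansion (f : ℝ → ℝ) (P : Set (Set ℝ)) (x : ℝ) : Prop :=
  ∃ ω, IsExpansion f P x ω

/-- In the `(α,β)`-game closed intervals are given by their pairs of endpoints; `K` is a legal
choice inside `J` with ratio `γ`. -/
def IsMove (γ : ℝ) (J K : ℝ × ℝ) : Prop :=
  Icc K.1 K.2 ⊆ Icc J.1 J.2 ∧ K.1 < K.2 ∧ K.2 - K.1 = γ * (J.2 - J.1)

/-- White's `k`-th interval when he uses the strategy `σ`, which answers the list
`B 0, …, B k` of Black's choices so far. -/
def white (σ : List (ℝ × ℝ) → ℝ × ℝ) (B : ℕ → ℝ × ℝ) (k : ℕ) : ℝ × ℝ :=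
  σ ((List.range (k + 1)).map B)

/-- In the `(α,β)`-game started by Black with `B 0 = I`, White has a strategy, always legal, such
that against every legal play of Black one of White's intervals satisfies `T`. -/
def WhiteCanReach (α β : ℝ) (I : ℝ × ℝ) (T : Set ℝ → Prop) : Prop :=
  ∃ σ : List (ℝ × ℝ) → ℝ × ℝ,
    (∀ B : ℕ → ℝ × ℝ, B 0 = I → ∀ k,
      (∀ j < k, IsMove β (white σ B j) (B (j + 1))) → IsMove α (B k) (white σ B k)) ∧
    (∀ B : ℕ → ℝ × ℝ, B 0 = I → (∀ j, IsMove β (white σ B j) (B (j + 1))) →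
      ∃ j, T (Icc (white σ B j).1 (white σ B j).2))

/-- White can enter a cylinder of any prescribed generation in the `(α₀,β)`-game. -/
def CanEnterCylinders (α₀ : ℝ) (f : ℝ → ℝ) (P : Set (Set ℝ)) : Prop :=
  ∀ k : ℕ, ∀ u v : ℝ, 0 ≤ u → u < v → v < 1 → ∀ β : ℝ, 0 < β → β < 1 →
    WhiteCanReach α₀ β (u, v) (fun W => ∃ C, IsCylinder f P k C ∧ W ⊆ C)

/-- The lengths of the cylinders shrink at a uniform rate. -/
def CylindersShrink (f : ℝ → ℝ) (P : Set (Set ℝ)) : Prop :=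
  ∃ g : ℕ → ℝ, Tendsto g atTop (𝓝 0) ∧
    ∀ ω : ℕ → Set ℝ, (∀ i, ω i ∈ P) → ∀ n m : ℕ, 1 ≤ n → 1 ≤ m →
      volume.real (cylinder f ω (n + m)) / volume.real (cylinder f ω n) ≤ g m

/-- The hypotheses on a map, with game constant `α₀`. -/
structure Admissible (α₀ : ℝ) (f : ℝ → ℝ) (P : Set (Set ℝ)) : Prop where
  fullShift : IsFullShiftMap f P
  enter : CanEnterCylinders α₀ f P
  shrink : CylindersShrink f P

/-- `G_f(x)`: the points whose whole orbit is defined (through the pieces) and does not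
accumulate at, or hit, `x`. -/
def G (f : ℝ → ℝ) (P : Set (Set ℝ)) (x : ℝ) : Set ℝ :=
  {y | HasExpansion f P y ∧ x ∉ closure (range fun n : ℕ => f^[n] y)}

/-- The points in whose expansion some initial word of the expansion of `x` never occurs. -/
def symbolicG (f : ℝ → ℝ) (P : Set (Set ℝ)) (x : ℝ) : Set ℝ :=
  {y | ∃ ω υ : ℕ → Set ℝ, IsExpansion f P x ω ∧ IsExpansion f P y υ ∧
    ∃ n : ℕ, 1 ≤ n ∧ ∀ k : ℕ, ∃ i < n, υ (k + i) ≠ ω i}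

/-- For every `n`, finitely many cylinders of generation `n` cover a neighbourhood of `x`
in `[0,1)`. -/
def LocallyFiniteAt (f : ℝ → ℝ) (P : Set (Set ℝ)) (x : ℝ) : Prop :=
  ∀ n : ℕ, ∃ F : Set (Set ℝ), F.Finite ∧ (∀ C ∈ F, IsCylinder f P n C) ∧
    ⋃₀ F ∈ 𝓝[Ico (0 : ℝ) 1] x

/-- The pieces `[j/b, (j+1)/b)` of `x ↦ b x mod 1`. -/
def mulPieces (b : ℕ) : Set (Set ℝ) :=
  {J | ∃ j : ℕ, j < b ∧ J = Ico ((j : ℝ) / b) (((j : ℝ) + 1) / b)}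

/-- The pieces `(1/(n+1), 1/n]`, within `[0,1)`, of the Gauss map. -/
def gaussPieces : Set (Set ℝ) :=
  {J | ∃ n : ℕ, 1 ≤ n ∧ J = Ioc (1 / ((n : ℝ) + 1)) (1 / (n : ℝ)) ∩ Ico 0 1}

end FullShift

/-! The dimension is bounded from below by constructing, for every large `K`, a `K`-ary tree of
intervals inside the intersection in question whose limit set has dimension at least
`log K / log (4 K / α)`; this tends to `1` (`le_dimH_of_separated_tree`, `dimH_avoiding`).

The tree consists of plays of the `(α, 1/(4K))`-game. White uses the strategies for entering
cylinders one after another, for all maps and all generations, so that every limit point has an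
expansion for every map and all cylinders around it have positive length. Black has `2K` candidates
for each answer, and keeps `K` of them. His choice serves to avoid obstacles: for the map `f i`
these are the cylinders of the form `υ₁ … υₘ ω₁ … ωₙ`, where `ω₁ … ωₙ` is a word that must not
occur. An obstacle is announced when Black's interval `B` has become comparable to
(and shorter than) the cylinder of `υ₁ … υₘ ω₁` around it. Such a cylinder contains an endpoint of
`B`, and for each endpoint there are boundedly many generations with this property, as the lengths
shrink uniformly; the obstacles inside are short compared with `B` if `n` is large
(`exists_obstacles`). Black controls the sum of `√(|b| / |B|)` over the obstacles `b` meeting `B`.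
A short obstacle meets at most one of the candidates, so on average over the `2K` candidates the sum
is multiplied by a factor of order `1/√K`, and it remains small along the `K` best
ones (`exists_good_children`, `le_dimH_of_targets_of_obstacles`). As the intervals shrink, no
obstacle of positive length can survive.

A word must not occur for the symbolic sets; for the topological ones it is enough to avoid three
cylinders, one containing `x` and one on each side of it (`LocallyFiniteAt.exists_three`).

For the examples, White with `α ≤ 1/2` can avoid every point of a countable set, in particular the
points outside the interiors of the cylinders of a given generation, and the limit point then has a
neighbourhood inside a cylinder (`whiteCanReach_of_countable`). The inverse branches of the iterates
are Möbius maps with bounded distortion, which gives the uniform shrinking of cylinders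
(`IsFullShiftMap.cylindersShrink`, `gauss_branch`). -/

namespace FullShift

/-! ### Hausdorff dimension of tree-like sets -/

/-- The state reached after `t` steps from `s₀` when the choices `c` are made successively. -/
def treeRun {S : Type*} {K : ℕ} (next : S → Fin K → S) (s₀ : S) (c : ℕ → Fin K) : ℕ → S
  | 0 => s₀
  | t + 1 => next (treeRun next s₀ c t) (c t)

theorem treeRun_congr {S : Type*} {K : ℕ} (next : S → Fin K → S) (s₀ : S) {c c' : ℕ → Fin K}
    {t : ℕ} (h : ∀ i < t, c i = c' i) : treeRun next s₀ c t = treeRun next s₀ c' t := by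
  induction t with
  | zero => rfl
  | succ t ih =>
    simp only [treeRun]
    rw [ih fun i hi => h i (by omega), h t (by omega)]

/-- A `K`-ary tree of nested intervals whose lengths are multiplied by `ρ` at each step, with
siblings separated by at least the length of a child, has a limit set of dimension at least
`log K / log (1/ρ)`. The reason is that the coding of the limit set, read as a `K`-adic expansion,
is a Hölder map onto `[0,1]` with that exponent. -/
theorem le_dimH_of_separated_tree {S : Type*} {K : ℕ} (hK : 2 ≤ K) {ρ : ℝ} (hρ : 0 < ρ)
    (hρ1 : ρ < 1) (I : S → ℝ × ℝ) (next : S → Fin K → S) (s₀ : S)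
    (hlt : ∀ s, (I s).1 < (I s).2)
    (hsub : ∀ s a, Icc (I (next s a)).1 (I (next s a)).2 ⊆ Icc (I s).1 (I s).2)
    (hlen : ∀ s a, (I (next s a)).2 - (I (next s a)).1 = ρ * ((I s).2 - (I s).1))
    (hsep : ∀ s a a', a ≠ a' → ∀ x ∈ Icc (I (next s a)).1 (I (next s a)).2,
      ∀ y ∈ Icc (I (next s a')).1 (I (next s a')).2, ρ * ((I s).2 - (I s).1) ≤ |x - y|) :
    ENNReal.ofReal (Real.log K / Real.log ρ⁻¹) ≤
      dimH {y : ℝ | ∃ c : ℕ → Fin K, ∀ t,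
        y ∈ Icc (I (treeRun next s₀ c t)).1 (I (treeRun next s₀ c t)).2} := by
  set E := {y : ℝ | ∃ c : ℕ → Fin K, ∀ t,
        y ∈ Icc (I (treeRun next s₀ c t)).1 (I (treeRun next s₀ c t)).2} with hE
  set L := (I s₀).2 - (I s₀).1 with hL
  have hL0 : 0 < L := sub_pos.2 (hlt s₀)
  have hlenT : ∀ c t, (I (treeRun next s₀ c t)).2 - (I (treeRun next s₀ c t)).1 = ρ ^ t * L := by
    intro c t
    induction t with
    | zero => simp [treeRun, hL]
    | succ t ih => simp only [treeRun]; rw [hlen, ih]; ring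
  have hK1 : (1 : ℝ) < K := by exact_mod_cast hK
  have hlogK : 0 < Real.log K := Real.log_pos hK1
  have hlogρ : 0 < Real.log ρ⁻¹ := Real.log_pos (one_lt_inv₀ hρ |>.2 hρ1)
  set r := Real.log K / Real.log ρ⁻¹ with hr
  have hr0 : 0 < r := div_pos hlogK hlogρ
  have hρr : ρ ^ r = (K : ℝ)⁻¹ := by
    rw [Real.rpow_def_of_pos hρ, hr, Real.log_inv, mul_div_assoc', mul_comm, mul_div_assoc]
    have : Real.log ρ ≠ 0 := by
      rw [Real.log_inv] at hlogρ; linarith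
    rw [div_neg, div_self this, mul_neg_one, Real.exp_neg, Real.exp_log (by linarith)]
  classical
  have hcode : ∀ y : ℝ, ∃ c : ℕ → Fin K, y ∈ E → ∀ t,
        y ∈ Icc (I (treeRun next s₀ c t)).1 (I (treeRun next s₀ c t)).2 := by
    intro y
    by_cases hy : y ∈ E
    · obtain ⟨c, hc⟩ := hy
      exact ⟨c, fun _ => hc⟩
    · exact ⟨fun _ => ⟨0, by omega⟩, fun h => absurd h hy⟩
  choose code hcode using hcode
  -- points whose codes first differ at index `t` are at distance at least `ρ ^ (t + 1) * L`
  have hdist : ∀ c c' : ℕ → Fin K, ∀ t, (∀ i < t, c i = c' i) → c t ≠ c' t → ∀ y y' : ℝ,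
      y ∈ Icc (I (treeRun next s₀ c (t + 1))).1 (I (treeRun next s₀ c (t + 1))).2 →
      y' ∈ Icc (I (treeRun next s₀ c' (t + 1))).1 (I (treeRun next s₀ c' (t + 1))).2 →
      ρ * (ρ ^ t * L) ≤ |y - y'| := by
    intro c c' t hlt' hne y y' hy hy'
    rw [← hlenT c t]
    simp only [treeRun] at hy hy'
    rw [← treeRun_congr next s₀ hlt'] at hy'
    exact hsep _ _ _ hne y hy y' hy'
  have hfirst : ∀ c c' : ℕ → Fin K, c ≠ c' → ∃ t, (∀ i < t, c i = c' i) ∧ c t ≠ c' t := by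
    intro c c' hne
    have hex : ∃ t, c t ≠ c' t := Function.ne_iff.1 hne
    exact ⟨Nat.find hex, fun i hi => not_not.1 (Nat.find_min hex hi), Nat.find_spec hex⟩
  have himage : (fun y => Real.ofDigits (code y)) '' E = Icc 0 1 := by
    apply Subset.antisymm
    · rintro _ ⟨y, -, rfl⟩
      exact ⟨Real.ofDigits_nonneg _, Real.ofDigits_le_one _⟩
    · intro u hu
      obtain ⟨c, -, rfl⟩ := Real.ofDigits_SurjOn (b := K) (by omega) hu
      have hne : (⋂ t, Icc (I (treeRun next s₀ c t)).1 (I (treeRun next s₀ c t)).2).Nonempty := by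
        apply IsCompact.nonempty_iInter_of_sequence_nonempty_isCompact_isClosed
        · intro t; exact hsub _ _
        · intro t; exact nonempty_Icc.2 (hlt _).le
        · exact isCompact_Icc
        · intro t; exact isClosed_Icc
      obtain ⟨y, hy⟩ := hne
      rw [mem_iInter] at hy
      have hyE : y ∈ E := ⟨c, hy⟩
      refine ⟨y, hyE, ?_⟩
      have : code y = c := by
        by_contra hne
        obtain ⟨t, h1, h2⟩ := hfirst _ _ hne
        have := hdist _ _ t h1 h2 y y (hcode y hyE _) (hy _)
        rw [sub_self, abs_zero] at this
        have : 0 < ρ * (ρ ^ t * L) := by positivity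
        linarith
      simp only [this]
  have hholder : HolderOnWith (Real.toNNReal ((ρ * L)⁻¹ ^ r)) (Real.toNNReal r)
      (fun y => Real.ofDigits (code y)) E := by
    intro y hy y' hy'
    have key : |Real.ofDigits (code y) - Real.ofDigits (code y')| ≤
        (ρ * L)⁻¹ ^ r * |y - y'| ^ r := by
      by_cases hc : code y = code y'
      · rw [hc, sub_self, abs_zero]; positivity
      · obtain ⟨t, h1, h2⟩ := hfirst _ _ hc
        have hd := hdist _ _ t h1 h2 y y' (hcode y hy _) (hcode y' hy' _)
        calc |Real.ofDigits (code y) - Real.ofDigits (code y')| ≤ ((K : ℝ) ^ t)⁻¹ :=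
              Real.abs_ofDigits_sub_ofDigits_le h1
          _ = (ρ ^ t) ^ r := by
              rw [← inv_pow, ← hρr, ← Real.rpow_natCast, ← Real.rpow_natCast,
                ← Real.rpow_mul hρ.le, ← Real.rpow_mul hρ.le, mul_comm]
          _ ≤ ((ρ * L)⁻¹ * |y - y'|) ^ r := by
              apply Real.rpow_le_rpow (by positivity) _ hr0.le
              rw [inv_mul_eq_div, le_div_iff₀ (by positivity)]
              linarith
          _ = (ρ * L)⁻¹ ^ r * |y - y'| ^ r := Real.mul_rpow (by positivity) (abs_nonneg _)
    rw [edist_dist, edist_dist, Real.dist_eq, Real.dist_eq, Real.coe_toNNReal _ hr0.le,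
      ENNReal.ofReal_rpow_of_nonneg (abs_nonneg _) hr0.le]
    change _ ≤ ENNReal.ofReal _ * _
    rw [← ENNReal.ofReal_mul (by positivity)]
    exact ENNReal.ofReal_le_ofReal key
  have h := hholder.dimH_image_le (Real.toNNReal_pos.2 hr0)
  have h1 : dimH (Icc (0 : ℝ) 1) = 1 := by
    have := Real.dimH_of_nonempty_interior (E := ℝ) (s := Icc 0 1) (by simp)
    simpa using this
  rw [himage, h1] at h
  change ((Real.toNNReal r : NNReal) : ENNReal) ≤ _
  have hr' : ((Real.toNNReal r : NNReal) : ENNReal) ≠ 0 := by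
    simpa using hr0
  have := (ENNReal.le_div_iff_mul_le (Or.inl hr') (Or.inl ENNReal.coe_ne_top)).1 h
  simpa using this

/-! ### Strategy trees -/

/-- White's strategy in the `(α,β)`-game from Black's interval `B`, as a well-founded tree: either
White has a move meeting the target `T`, or a move together with a strategy tree for each of
Black's answers. -/
inductive Strat (α β : ℝ) (T : Set ℝ → Prop) : ℝ × ℝ → Type
  | reach {B : ℝ × ℝ} (W : ℝ × ℝ) (hW : IsMove α B W) (hT : T (Icc W.1 W.2)) : Strat α β T B
  | step {B : ℝ × ℝ} (W : ℝ × ℝ) (hW : IsMove α B W)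
      (next : ∀ B', IsMove β W B' → Strat α β T B') : Strat α β T B

/-- Otherwise Black could play forever through positions without a strategy tree. -/
theorem WhiteCanReach.nonempty_strat {α β : ℝ} {I : ℝ × ℝ} {T : Set ℝ → Prop}
    (h : WhiteCanReach α β I T) : Nonempty (Strat α β T I) := by
  classical
  by_contra hno
  obtain ⟨σ, hlegal, hreach⟩ := h
  let answer : List (ℝ × ℝ) → ℝ × ℝ := fun l =>
    if hex : ∃ B', IsMove β (σ l) B' ∧ ¬ Nonempty (Strat α β T B') then hex.choose else (0, 0)
  let hist : ℕ → List (ℝ × ℝ) := fun k => Nat.rec [I] (fun _ l => l ++ [answer l]) k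
  let B : ℕ → ℝ × ℝ := fun k => Nat.casesOn k I fun j => answer (hist j)
  have hhist : ∀ k, (List.range (k + 1)).map B = hist k := by
    intro k
    induction k with
    | zero => rfl
    | succ k ih => rw [List.range_succ, List.map_append, ih]; rfl
  have hwhite : ∀ k, white σ B k = σ (hist k) := fun k => by rw [white, hhist]
  have key : ∀ k, ¬ Nonempty (Strat α β T (B k)) ∧
      ∀ j < k, IsMove β (white σ B j) (B (j + 1)) := by
    intro k
    induction k with
    | zero => exact ⟨hno, by simp⟩
    | succ k ih =>
      obtain ⟨hk, hleg⟩ := ih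
      have hW := hlegal B rfl k hleg
      have hex : ∃ B', IsMove β (σ (hist k)) B' ∧ ¬ Nonempty (Strat α β T B') := by
        by_contra hcon
        push Not at hcon
        rw [hwhite] at hW
        exact hk ⟨.step _ hW fun B' hB' => (hcon B' hB').some⟩
      have hB : B (k + 1) = hex.choose := dif_pos hex
      refine ⟨hB ▸ hex.choose_spec.2, fun j hj => ?_⟩
      rcases Nat.lt_succ_iff_lt_or_eq.1 hj with hj | rfl
      · exact hleg j hj
      · rw [hwhite, hB]
        exact hex.choose_spec.1
  obtain ⟨j, hj⟩ := hreach B rfl fun j => (key (j + 1)).2 j j.lt_succ_self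
  exact (key j).1 ⟨.reach _ (hlegal B rfl j (key j).2) hj⟩

/-- White's next interval in a strategy tree. -/
def Strat.move {α β : ℝ} {T : Set ℝ → Prop} {B : ℝ × ℝ} : Strat α β T B → ℝ × ℝ
  | .reach W _ _ => W
  | .step W _ _ => W

theorem Strat.isMove {α β : ℝ} {T : Set ℝ → Prop} {B : ℝ × ℝ} (s : Strat α β T B) :
    IsMove α B s.move := by
  cases s with
  | reach W hW hT => exact hW
  | step W hW next => exact hW

/-- A position when White pursues the targets `T 0, T 1, …` one after another: the number of the
current target, Black's interval, and White's strategy tree for this target. -/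
structure Position (α β : ℝ) (T : ℕ → Set ℝ → Prop) where
  goal : ℕ
  box : ℝ × ℝ
  strat : Strat α β (T goal) box

/-- One round of the game; once a target is met, White turns to the next one. -/
inductive Position.Step {α β : ℝ} {T : ℕ → Set ℝ → Prop} :
    Position α β T → Position α β T → Prop
  | reach {j : ℕ} {B W B' : ℝ × ℝ} {hW : IsMove α B W} {hT : T j (Icc W.1 W.2)}
      (h : IsMove β W B') (s : Strat α β (T (j + 1)) B') :
      Position.Step ⟨j, B, .reach W hW hT⟩ ⟨j + 1, B', s⟩
  | step {j : ℕ} {B W B' : ℝ × ℝ} {hW : IsMove α B W}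
      {next : ∀ B', IsMove β W B' → Strat α β (T j) B'} (h : IsMove β W B') :
      Position.Step ⟨j, B, .step W hW next⟩ ⟨j, B', next B' h⟩

theorem Position.exists_step {α β : ℝ} {T : ℕ → Set ℝ → Prop} (p : Position α β T)
    {B' : ℝ × ℝ} (h : IsMove β p.strat.move B') (hB' : ∀ j, Nonempty (Strat α β (T j) B')) :
    ∃ p' : Position α β T, p.Step p' ∧ p'.box = B' := by
  obtain ⟨j, B, s⟩ := p
  cases s with
  | reach W hW hT => exact ⟨_, .reach h (hB' (j + 1)).some, rfl⟩
  | step W hW next => exact ⟨_, .step h, rfl⟩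

theorem Position.exists_goal_succ {α β : ℝ} {T : ℕ → Set ℝ → Prop} {p : ℕ → Position α β T}
    (hp : ∀ n, (p n).Step (p (n + 1))) {j : ℕ} {B : ℝ × ℝ} (s : Strat α β (T j) B) (n : ℕ)
    (hn : p n = ⟨j, B, s⟩) :
    ∃ n', (p n').goal = j + 1 ∧ ∃ W : ℝ × ℝ, W.1 < W.2 ∧ T j (Icc W.1 W.2) ∧
      Icc (p n').box.1 (p n').box.2 ⊆ Icc W.1 W.2 := by
  induction s generalizing n with
  | @reach B W hW hT =>
    have h := hp n
    rw [hn] at h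
    generalize hq : p (n + 1) = q at h
    cases h with
    | reach h s =>
      refine ⟨n + 1, ?_, W, hW.2.1, hT, ?_⟩
      · rw [hq]
      · rw [hq]; exact h.1
  | @step B W hW next ih =>
    have h := hp n
    rw [hn] at h
    generalize hq : p (n + 1) = q at h
    cases h with
    | step h => exact ih _ h (n + 1) hq

theorem Position.exists_reached {α β : ℝ} {T : ℕ → Set ℝ → Prop} {p : ℕ → Position α β T}
    (hp : ∀ n, (p n).Step (p (n + 1))) (h0 : (p 0).goal = 0) (j : ℕ) :
    ∃ n, ∃ W : ℝ × ℝ, W.1 < W.2 ∧ T j (Icc W.1 W.2) ∧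
      Icc (p n).box.1 (p n).box.2 ⊆ Icc W.1 W.2 := by
  have hgoal : ∀ j, ∃ n, (p n).goal = j := by
    intro j
    induction j with
    | zero => exact ⟨0, h0⟩
    | succ j ih =>
      obtain ⟨n, rfl⟩ := ih
      obtain ⟨n', hn', -⟩ := exists_goal_succ hp (p n).strat n rfl
      exact ⟨n', hn'⟩
  obtain ⟨n, rfl⟩ := hgoal j
  obtain ⟨n', -, hW⟩ := exists_goal_succ hp (p n).strat n rfl
  exact ⟨n', hW⟩

/-! ### The potential of a family of obstacles -/

theorem abs_sub_le_volume_real {b : Set ℝ} (hb : b.OrdConnected) (hb' : b ⊆ Ico 0 1) {x y : ℝ}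
    (hx : x ∈ b) (hy : y ∈ b) : |x - y| ≤ volume.real b := by
  have h := measureReal_mono (μ := volume) (hb.uIcc_subset hy hx)
    (ne_top_of_le_ne_top (by simp) (measure_mono (μ := volume) hb'))
  rwa [measureReal_def, Real.volume_interval, ENNReal.toReal_ofReal (abs_nonneg _)] at h

open Classical in
/-- The weight of the obstacle `b` in the interval `B`. An obstacle shorter than the gaps between
the `2K` candidate subintervals of `B` enters at most one of them, and owing to the square root its
weight grows there only by a factor of order `√K`, which is small compared with `2K`. -/
noncomputable def weight (B : ℝ × ℝ) (b : Set ℝ) : ℝ :=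
  if (b ∩ Icc B.1 B.2).Nonempty then √(volume.real b / (B.2 - B.1)) else 0

/-- The total weight of a list of obstacles in the interval `B`. -/
noncomputable def potential (B : ℝ × ℝ) (l : List (Set ℝ)) : ℝ := (l.map (weight B)).sum

theorem weight_nonneg (B : ℝ × ℝ) (b : Set ℝ) : 0 ≤ weight B b := by
  unfold weight; split_ifs <;> positivity

theorem weight_le (B : ℝ × ℝ) (b : Set ℝ) : weight B b ≤ √(volume.real b / (B.2 - B.1)) := by
  unfold weight; split_ifs
  · exact le_rfl
  · positivity

theorem weight_le_potential (B : ℝ × ℝ) {l : List (Set ℝ)} {b : Set ℝ} (hb : b ∈ l) :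
    weight B b ≤ potential B l :=
  List.single_le_sum (by simpa using fun _ _ => weight_nonneg _ _) _ (List.mem_map_of_mem hb)

theorem potential_append (B : ℝ × ℝ) (l l' : List (Set ℝ)) :
    potential B (l ++ l') = potential B l + potential B l' := by
  simp [potential]

theorem potential_cons (B : ℝ × ℝ) (b : Set ℝ) (l : List (Set ℝ)) :
    potential B (b :: l) = weight B b + potential B l := by
  simp [potential]

theorem potential_nonneg (B : ℝ × ℝ) (l : List (Set ℝ)) : 0 ≤ potential B l :=
  List.sum_nonneg (by simpa using fun _ _ => weight_nonneg _ _)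

/-- The `l`-th of the equally spaced candidates for Black's answer to `W`; they have relative
length `1/(4K)`, and so do the gaps between them. -/
noncomputable def child (K : ℕ) (W : ℝ × ℝ) (l : ℕ) : ℝ × ℝ :=
  (W.1 + 2 * l * (1 / (4 * K) * (W.2 - W.1)), W.1 + (2 * l + 1) * (1 / (4 * K) * (W.2 - W.1)))

theorem child_length (K : ℕ) (W : ℝ × ℝ) (l : ℕ) :
    (child K W l).2 - (child K W l).1 = 1 / (4 * K) * (W.2 - W.1) := by
  simp only [child]; ring

theorem isMove_child {K : ℕ} (hK : 0 < K) {W : ℝ × ℝ} (hW : W.1 < W.2) {l : ℕ} (hl : l < 2 * K) :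
    IsMove (1 / (4 * K)) W (child K W l) := by
  have hK' : (0 : ℝ) < K := by exact_mod_cast hK
  have hd : 0 < 1 / (4 * (K : ℝ)) * (W.2 - W.1) :=
    mul_pos (by positivity) (sub_pos.2 hW)
  refine ⟨?_, ?_, child_length K W l⟩
  · apply Icc_subset_Icc
    · simp only [child]
      have : 0 ≤ 2 * (l : ℝ) * (1 / (4 * K) * (W.2 - W.1)) := by positivity
      linarith
    · simp only [child]
      have hl' : (2 * (l : ℝ) + 1) ≤ 4 * K := by
        have : l + 1 ≤ 2 * K := hl
        have : (l : ℝ) + 1 ≤ 2 * K := by exact_mod_cast this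
        linarith
      have h1 := mul_le_mul_of_nonneg_right hl' hd.le
      have h2 : 4 * (K : ℝ) * (1 / (4 * K) * (W.2 - W.1)) = W.2 - W.1 := by
        field_simp
      linarith
  · have := child_length K W l
    linarith

theorem child_separated {K : ℕ} {W : ℝ × ℝ} (hW : W.1 < W.2) {l l' : ℕ} (hl : l ≠ l')
    {x y : ℝ} (hx : x ∈ Icc (child K W l).1 (child K W l).2)
    (hy : y ∈ Icc (child K W l').1 (child K W l').2) :
    1 / (4 * K) * (W.2 - W.1) ≤ |x - y| := by
  have hd : 0 ≤ 1 / (4 * (K : ℝ)) * (W.2 - W.1) :=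
    mul_nonneg (by positivity) (sub_pos.2 hW).le
  wlog h : l < l' generalizing l l' x y
  · rw [abs_sub_comm]
    exact this hl.symm hy hx (by omega)
  simp only [child, mem_Icc] at hx hy
  generalize 1 / (4 * (K : ℝ)) * (W.2 - W.1) = d at *
  have h' : (l : ℝ) + 1 ≤ l' := by exact_mod_cast h
  have := mul_le_mul_of_nonneg_right h' hd
  rw [abs_sub_comm]
  refine le_trans ?_ (le_abs_self _)
  linarith

theorem sum_weight_child_le {α : ℝ} (hα : 0 < α) (hα1 : α < 1) {K : ℕ} (hK : 0 < K)
    {B W : ℝ × ℝ} (hB : B.1 < B.2) (hW : IsMove α B W) {b : Set ℝ} (hb : b.OrdConnected)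
    (hb' : b ⊆ Ico 0 1) (hwt : weight B b ≤ α * (1 / (4 * K))) :
    ∑ l : Fin (2 * K), weight (child K W l) b ≤ (√(α * (1 / (4 * K))))⁻¹ * weight B b := by
  have hK' : (1 : ℝ) ≤ K := by exact_mod_cast hK
  set ρ := α * (1 / (4 * K)) with hρ
  have hρ0 : 0 < ρ := by positivity
  have hρ1 : ρ < 1 := by
    have : 1 / (4 * (K : ℝ)) ≤ 1 := by
      rw [div_le_one (by positivity)]; linarith
    calc ρ ≤ α * 1 := by rw [hρ]; gcongr
      _ < 1 := by linarith
  have hB0 : 0 < B.2 - B.1 := sub_pos.2 hB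
  have hlen : 1 / (4 * (K : ℝ)) * (W.2 - W.1) = ρ * (B.2 - B.1) := by
    rw [hW.2.2]; ring
  by_cases hex : ∃ l₀ : Fin (2 * K), (b ∩ Icc (child K W l₀).1 (child K W l₀).2).Nonempty
  · obtain ⟨l₀, x, hxb, hx⟩ := hex
    have hxB : x ∈ Icc B.1 B.2 := hW.1 ((isMove_child hK hW.2.1 l₀.2).1 hx)
    have hwB : weight B b = √(volume.real b / (B.2 - B.1)) := if_pos ⟨x, hxb, hxB⟩
    have hvol : volume.real b < ρ * (B.2 - B.1) := by
      rw [hwB, Real.sqrt_le_left hρ0.le, div_le_iff₀ hB0] at hwt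
      calc volume.real b ≤ ρ ^ 2 * (B.2 - B.1) := hwt
        _ < ρ * (B.2 - B.1) := by
            apply mul_lt_mul_of_pos_right _ hB0
            nlinarith
    rw [Finset.sum_eq_single l₀]
    · refine (weight_le _ _).trans ?_
      rw [child_length, hlen, hwB, ← Real.sqrt_inv, ← Real.sqrt_mul (by positivity)]
      apply Real.sqrt_le_sqrt
      rw [div_mul_eq_div_div, inv_mul_eq_div, div_right_comm]
    · intro l _ hl
      apply if_neg
      rintro ⟨y, hyb, hy⟩
      have h1 := child_separated hW.2.1 (fun h => hl (Fin.ext h)) hy hx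
      have h2 := abs_sub_le_volume_real hb hb' hyb hxb
      linarith
    · simp
  · push Not at hex
    rw [Finset.sum_eq_zero]
    · exact mul_nonneg (by positivity) (weight_nonneg _ _)
    · intro l _
      apply if_neg
      rw [hex l]
      simp

/-- Averaging over the `2K` candidates: at least `K` of them have small potential. -/
theorem exists_good_children {α : ℝ} (hα : 0 < α) (hα1 : α < 1) {K : ℕ} (hK : 16 / α ≤ K)
    {B W : ℝ × ℝ} (hB : B.1 < B.2) (hW : IsMove α B W) {l : List (Set ℝ)}
    (hl : ∀ b ∈ l, b.OrdConnected ∧ b ⊆ Ico 0 1) (hpot : potential B l ≤ α * (1 / (4 * K))) :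
    ∃ e : Fin K → Fin (2 * K), Function.Injective e ∧
      ∀ a, potential (child K W (e a)) l ≤ α * (1 / (4 * K)) / 2 := by
  classical
  have hK0 : (0 : ℝ) < K := lt_of_lt_of_le (by positivity) hK
  have hK1 : 0 < K := by exact_mod_cast hK0
  set ρ := α * (1 / (4 * K)) with hρ
  have hρ0 : 0 < ρ := by positivity
  have hsum : ∑ i : Fin (2 * K), potential (child K W i) l ≤ (√ρ)⁻¹ * potential B l := by
    have hw : ∀ b ∈ l, weight B b ≤ ρ := fun b hb => (weight_le_potential B hb).trans hpot
    clear hpot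
    induction l with
    | nil => simp [potential]
    | cons b l ih =>
      simp only [potential_cons, Finset.sum_add_distrib, mul_add]
      refine add_le_add ?_ (ih (fun b' hb' => hl b' (by simp [hb'])) fun b' hb' => hw b' (by simp [hb']))
      exact sum_weight_child_le hα hα1 hK1 hB hW (hl b (by simp)).1 (hl b (by simp)).2
        (hw b (by simp))
  set good := Finset.univ.filter fun i : Fin (2 * K) => potential (child K W i) l ≤ ρ / 2
    with hgood
  have hcard : K ≤ good.card := by
    by_contra hlt
    push Not at hlt
    have hc : good.card + goodᶜ.card = 2 * K := by
      rw [Finset.card_add_card_compl, Fintype.card_fin]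
    have hc' : (K : ℝ) + 1 ≤ goodᶜ.card := by
      have : K + 1 ≤ goodᶜ.card := by omega
      exact_mod_cast this
    have h1 : (goodᶜ.card : ℝ) * (ρ / 2) ≤ ∑ i : Fin (2 * K), potential (child K W i) l := by
      rw [← nsmul_eq_mul]
      refine (Finset.card_nsmul_le_sum goodᶜ _ _ fun i hi => ?_).trans
        (Finset.sum_le_sum_of_subset_of_nonneg (Finset.subset_univ _) fun i _ _ =>
          potential_nonneg _ _)
      simp only [hgood, Finset.mem_compl, Finset.mem_filter, Finset.mem_univ, true_and,
        not_le] at hi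
      exact hi.le
    have h2 : (√ρ)⁻¹ * potential B l ≤ √ρ := by
      rw [inv_mul_le_iff₀ (Real.sqrt_pos.2 hρ0), Real.mul_self_sqrt hρ0.le]
      exact hpot
    have h3 : 2 ≤ K * √ρ := by
      have h16 : 16 ≤ K * α := by rwa [div_le_iff₀ hα] at hK
      apply le_of_sq_le_sq _ (by positivity)
      rw [mul_pow, Real.sq_sqrt hρ0.le, hρ]
      have : (K : ℝ) ^ 2 * (α * (1 / (4 * K))) = K * α / 4 := by field_simp
      rw [this]; linarith
    have h4 : √ρ * √ρ = ρ := Real.mul_self_sqrt hρ0.le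
    have h5 : 0 < √ρ := Real.sqrt_pos.2 hρ0
    nlinarith
  exact ⟨good.orderEmbOfCardLe hcard, (good.orderEmbOfCardLe hcard).injective, fun a =>
    (Finset.mem_filter.1 (good.orderEmbOfCardLe_mem hcard a)).2⟩

/-- The limit points along which White meets all the targets `T j`, while Black, who has `K` good
answers in each round, avoids all the obstacles of positive length that are announced with each of
his intervals. The obstacles announced with one interval may be numerous, but have to be short. -/
theorem le_dimH_of_targets_of_obstacles {α : ℝ} (hα : 0 < α) (hα1 : α < 1) {K : ℕ}
    (hK : 16 / α ≤ K) {ρ : ℝ} (hρ : ρ = α * (1 / (4 * K))) (T : ℕ → Set ℝ → Prop)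
    (hT : ∀ j u v, 0 ≤ u → u < v → v < 1 → WhiteCanReach α (1 / (4 * K)) (u, v) (T j))
    (newBad : ℕ → ℝ × ℝ → List (Set ℝ))
    (hbad : ∀ t B, ∀ b ∈ newBad t B, b.OrdConnected ∧ b ⊆ Ico 0 1)
    (hsum : ∀ t (B : ℝ × ℝ), B.2 - B.1 = ρ ^ t / 2 → potential B (newBad t B) ≤ ρ / 2) :
    ENNReal.ofReal (Real.log K / Real.log ρ⁻¹) ≤
      dimH {y : ℝ | ∃ B : ℕ → ℝ × ℝ,
        (∀ t, (B t).2 - (B t).1 = ρ ^ t / 2 ∧ y ∈ Icc (B t).1 (B t).2) ∧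
        (∀ j, ∃ W : ℝ × ℝ, W.1 < W.2 ∧ y ∈ Icc W.1 W.2 ∧ T j (Icc W.1 W.2)) ∧
        ∀ t, ∀ b ∈ newBad t (B t), y ∈ b → volume.real b = 0} := by
  have hK0 : (0 : ℝ) < K := lt_of_lt_of_le (by positivity) hK
  have hK1 : 0 < K := by exact_mod_cast hK0
  have hK16 : (16 : ℝ) ≤ K := by
    refine le_trans ?_ hK
    rw [le_div_iff₀ hα]; linarith
  have hK2 : 2 ≤ K := by
    have : 16 ≤ K := by exact_mod_cast hK16
    omega
  have hρ0 : 0 < ρ := by rw [hρ]; positivity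
  have hρ1 : ρ < 1 := by
    have : 1 / (4 * (K : ℝ)) ≤ 1 := by
      rw [div_le_one (by positivity)]; linarith
    calc ρ ≤ α * 1 := by rw [hρ]; gcongr
      _ < 1 := by linarith
  have hstrat : ∀ B : ℝ × ℝ, 0 ≤ B.1 → B.1 < B.2 → B.2 < 1 → ∀ j,
      Nonempty (Strat α (1 / (4 * K)) (T j) B) := fun B h1 h2 h3 j =>
    (hT j B.1 B.2 h1 h2 h3).nonempty_strat
  -- the states of the tree: number of rounds, position in the game, obstacles announced so far
  let S := {s : ℕ × Position α (1 / (4 * K)) T × List (Set ℝ) //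
    s.2.1.box.2 - s.2.1.box.1 = ρ ^ s.1 / 2 ∧ 0 ≤ s.2.1.box.1 ∧ s.2.1.box.2 < 1 ∧
    (∀ b ∈ s.2.2, b.OrdConnected ∧ b ⊆ Ico 0 1) ∧ potential s.2.1.box s.2.2 ≤ ρ ∧
    ∀ b ∈ newBad s.1 s.2.1.box, b ∈ s.2.2}
  have hlt : ∀ s : S, s.1.2.1.box.1 < s.1.2.1.box.2 := by
    intro s
    have := s.2.1
    have : 0 < ρ ^ s.1.1 / 2 := by positivity
    linarith
  have hstep : ∀ s : S, ∃ next : Fin K → S,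
      (∀ a, s.1.2.1.Step (next a).1.2.1 ∧ (next a).1.1 = s.1.1 + 1 ∧ s.1.2.2 ⊆ (next a).1.2.2) ∧
      ∃ W, IsMove α s.1.2.1.box W ∧ ∃ e : Fin K → Fin (2 * K), Function.Injective e ∧
        ∀ a, (next a).1.2.1.box = child K W (e a) := by
    intro s
    obtain ⟨hlen, h0, h1, hb, hpot, -⟩ := s.2
    have hW := s.1.2.1.strat.isMove
    set W := s.1.2.1.strat.move with hWdef
    obtain ⟨e, he, hgood⟩ := exists_good_children hα hα1 hK (hlt s) hW hb (hρ ▸ hpot)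
    have hnext : ∀ a : Fin K, ∃ s' : S, (s.1.2.1.Step s'.1.2.1 ∧ s'.1.1 = s.1.1 + 1 ∧
        s.1.2.2 ⊆ s'.1.2.2) ∧ s'.1.2.1.box = child K W (e a) := by
      intro a
      have hmv := isMove_child hK1 hW.2.1 (e a).2
      have hlen' : (child K W (e a)).2 - (child K W (e a)).1 = ρ ^ (s.1.1 + 1) / 2 := by
        rw [hmv.2.2, hW.2.2, hlen, pow_succ]
        linear_combination (-(ρ ^ s.1.1 / 2)) * hρ
      have hsub := hmv.1.trans hW.1
      have hl : child K W (e a) ∈ {B : ℝ × ℝ | 0 ≤ B.1 ∧ B.2 < 1} := by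
        have hl1 := hsub (left_mem_Icc.2 hmv.2.1.le)
        have hr1 := hsub (right_mem_Icc.2 hmv.2.1.le)
        exact ⟨h0.trans hl1.1, hr1.2.trans_lt h1⟩
      obtain ⟨p, hp, hbox⟩ := s.1.2.1.exists_step hmv
        fun j => hstrat _ hl.1 hmv.2.1 hl.2 j
      refine ⟨⟨(s.1.1 + 1, p, newBad (s.1.1 + 1) p.box ++ s.1.2.2), ?_⟩, ⟨hp, rfl, ?_⟩, hbox⟩
      · simp only
        rw [hbox]
        refine ⟨hlen', hl.1, hl.2, ?_, ?_, ?_⟩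
        · intro b hb'
          rcases List.mem_append.1 hb' with hb' | hb'
          · exact hbad _ _ b hb'
          · exact hb b hb'
        · rw [potential_append]
          have h2 := hsum _ _ hlen'
          have h3 := hgood a
          rw [← hρ] at h3
          linarith
        · exact fun b hb' => List.mem_append_left _ hb'
      · exact List.subset_append_right _ _
    choose next hnext hbox using hnext
    exact ⟨next, hnext, W, hW, e, he, hbox⟩
  choose next hnext W hW e he hbox using hstep
  have hs₀ : ∃ s : S, s.1.1 = 0 ∧ s.1.2.1.goal = 0 := by
    have hl : ((1 : ℝ) / 2) - 0 = ρ ^ 0 / 2 := by norm_num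
    refine ⟨⟨(0, ⟨0, (0, 1 / 2), (hstrat (0, 1 / 2) le_rfl (by norm_num) (by norm_num) 0).some⟩,
      newBad 0 (0, 1 / 2)), hl, le_rfl, by norm_num, hbad _ _, ?_, fun b hb => hb⟩, rfl, rfl⟩
    have := hsum 0 (0, 1 / 2) hl
    simp only
    linarith
  obtain ⟨s₀, hs₀, hgoal⟩ := hs₀
  refine (le_dimH_of_separated_tree hK2 hρ0 hρ1 (fun s : S => s.1.2.1.box) next s₀ hlt
    ?_ ?_ ?_).trans (dimH_mono ?_)
  · intro s a
    rw [hbox]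
    exact (isMove_child hK1 (hW s).2.1 (e s a).2).1.trans (hW s).1
  · intro s a
    rw [hbox, child_length, (hW s).2.2]
    linear_combination (-((s.1.2.1.box).2 - (s.1.2.1.box).1)) * hρ
  · intro s a a' haa x hx y hy
    rw [hbox] at hx hy
    have h := child_separated (hW s).2.1 (fun h => haa (he s (Fin.ext h))) hx hy
    rw [(hW s).2.2] at h
    refine le_of_eq_of_le ?_ h
    linear_combination ((s.1.2.1.box).2 - (s.1.2.1.box).1) * hρ
  · rintro y ⟨c, hy⟩
    have htime : ∀ t, (treeRun next s₀ c t).1.1 = t := by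
      intro t
      induction t with
      | zero => exact hs₀
      | succ t ih => simp only [treeRun]; rw [(hnext _ _).2.1, ih]
    have hlen : ∀ t, (treeRun next s₀ c t).1.2.1.box.2 - (treeRun next s₀ c t).1.2.1.box.1 =
        ρ ^ t / 2 := fun t => by rw [(treeRun next s₀ c t).2.1, htime]
    refine ⟨fun t => (treeRun next s₀ c t).1.2.1.box, fun t => ⟨hlen t, hy t⟩, ?_, ?_⟩
    · intro j
      obtain ⟨n, W, h1, h2, h3⟩ := Position.exists_reached
        (p := fun t => (treeRun next s₀ c t).1.2.1) (fun t => (hnext _ _).1) hgoal j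
      exact ⟨W, h1, h3 (hy n), h2⟩
    · intro t b hb hyb
      have hmem : ∀ u, b ∈ (treeRun next s₀ c (t + u)).1.2.2 := by
        intro u
        induction u with
        | zero =>
          apply (treeRun next s₀ c t).2.2.2.2.2.2
          rwa [htime]
        | succ u ih => exact (hnext _ _).2.2 ih
      -- the weight of `b` in the intervals around `y` stays bounded, although they shrink
      have hle : ∀ u, volume.real b ≤ ρ ^ 2 * (ρ ^ (t + u) / 2) := by
        intro u
        have h1 := (weight_le_potential _ (hmem u)).trans (treeRun next s₀ c (t + u)).2.2.2.2.2.1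
        rw [weight, if_pos ⟨y, hyb, hy _⟩, hlen, Real.sqrt_le_left hρ0.le,
          div_le_iff₀ (by positivity)] at h1
        exact h1
      have hlim : Tendsto (fun u : ℕ => ρ ^ 2 * (ρ ^ (t + u) / 2)) atTop (𝓝 (ρ ^ 2 * (0 / 2))) := by
        refine Tendsto.const_mul _ (Tendsto.div_const ?_ _)
        have h := (tendsto_pow_atTop_nhds_zero_of_lt_one hρ0.le hρ1).comp (tendsto_add_atTop_nat t)
        refine h.congr fun u => ?_
        simp [add_comm]
      have := ge_of_tendsto' hlim hle
      exact le_antisymm (by simpa using this) measureReal_nonneg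

/-! ### Cylinders -/

theorem IsFullShiftMap.ordConnected {f : ℝ → ℝ} {P : Set (Set ℝ)} (h : IsFullShiftMap f P)
    {J : Set ℝ} (hJ : J ∈ P) : J.OrdConnected := by
  obtain ⟨-, a, b, -, h1, h2⟩ := h.interval J hJ
  refine ⟨fun x hx y hy z hz => ?_⟩
  rcases eq_or_lt_of_le hz.1 with rfl | hxz
  · exact hx
  rcases eq_or_lt_of_le hz.2 with rfl | hzy
  · exact hy
  exact h1 ⟨(h2 hx).1.trans_lt hxz, hzy.trans_le (h2 hy).2⟩

theorem IsFullShiftMap.eq_of_mem {f : ℝ → ℝ} {P : Set (Set ℝ)} (h : IsFullShiftMap f P)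
    {J J' : Set ℝ} (hJ : J ∈ P) (hJ' : J' ∈ P) {x : ℝ} (hx : x ∈ J) (hx' : x ∈ J') : J = J' :=
  h.disjoint.elim_set hJ hJ' x hx hx'

theorem cylinder_subset_Ico (f : ℝ → ℝ) (ω : ℕ → Set ℝ) (n : ℕ) : cylinder f ω n ⊆ Ico 0 1 :=
  fun _ hx => hx.1

theorem cylinder_anti (f : ℝ → ℝ) (ω : ℕ → Set ℝ) {m n : ℕ} (h : m ≤ n) :
    cylinder f ω n ⊆ cylinder f ω m :=
  fun _ hx => ⟨hx.1, fun i hi => hx.2 i (hi.trans_le h)⟩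

theorem cylinder_congr (f : ℝ → ℝ) {ω ω' : ℕ → Set ℝ} {n : ℕ} (h : ∀ i < n, ω i = ω' i) :
    cylinder f ω n = cylinder f ω' n := by
  ext x
  refine and_congr_right fun _ => forall₂_congr fun i hi => ?_
  rw [h i hi]

theorem IsFullShiftMap.eq_of_mem_cylinder {f : ℝ → ℝ} {P : Set (Set ℝ)} (h : IsFullShiftMap f P)
    {ω ω' : ℕ → Set ℝ} (hω : ∀ i, ω i ∈ P) (hω' : ∀ i, ω' i ∈ P) {n : ℕ} {x : ℝ}
    (hx : x ∈ cylinder f ω n) (hx' : x ∈ cylinder f ω' n) : ∀ i < n, ω i = ω' i :=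
  fun i hi => h.eq_of_mem (hω i) (hω' i) (hx.2 i hi) (hx'.2 i hi)

theorem IsFullShiftMap.mem_cylinder_succ {f : ℝ → ℝ} {P : Set (Set ℝ)} (h : IsFullShiftMap f P)
    {ω : ℕ → Set ℝ} (hω : ω 0 ∈ P) {n : ℕ} {x : ℝ} :
    x ∈ cylinder f ω (n + 1) ↔ x ∈ ω 0 ∧ f x ∈ cylinder f (fun i => ω (i + 1)) n := by
  constructor
  · intro hx
    have h0 : x ∈ ω 0 := hx.2 0 n.succ_pos
    exact ⟨h0, (h.onto _ hω).2 (mem_image_of_mem f h0), fun i hi => hx.2 (i + 1) (by omega)⟩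
  · rintro ⟨h0, hx⟩
    refine ⟨(h.interval _ hω).1 h0, fun i hi => ?_⟩
    cases i with
    | zero => exact h0
    | succ i => exact hx.2 i (by omega)

theorem IsFullShiftMap.ordConnected_cylinder {f : ℝ → ℝ} {P : Set (Set ℝ)}
    (h : IsFullShiftMap f P) {ω : ℕ → Set ℝ} (hω : ∀ i, ω i ∈ P) (n : ℕ) :
    (cylinder f ω n).OrdConnected := by
  induction n generalizing ω with
  | zero =>
    have : cylinder f ω 0 = Ico 0 1 := by
      ext x; simp [cylinder]
    rw [this]
    exact ordConnected_Ico
  | succ n ih =>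
    have ih' := ih (fun i => hω (i + 1))
    refine ⟨fun x hx y hy z hz => ?_⟩
    rw [h.mem_cylinder_succ (hω 0)] at hx hy ⊢
    have hzJ : z ∈ ω 0 := (h.ordConnected (hω 0)).out hx.1 hy.1 hz
    refine ⟨hzJ, ?_⟩
    rcases h.monotone _ (hω 0) with hm | hm
    · exact ih'.out hx.2 hy.2 ⟨hm hx.1 hzJ hz.1, hm hzJ hy.1 hz.2⟩
    · exact ih'.out hy.2 hx.2 ⟨hm hzJ hy.1 hz.2, hm hx.1 hzJ hz.1⟩

theorem volume_cylinder_ne_top (f : ℝ → ℝ) (ω : ℕ → Set ℝ) (n : ℕ) :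
    volume (cylinder f ω n) ≠ ⊤ :=
  ne_top_of_le_ne_top (by simp) (measure_mono (μ := volume) (cylinder_subset_Ico f ω n))

theorem volume_real_cylinder_anti (f : ℝ → ℝ) (ω : ℕ → Set ℝ) {m n : ℕ} (h : m ≤ n) :
    volume.real (cylinder f ω n) ≤ volume.real (cylinder f ω m) :=
  measureReal_mono (cylinder_anti f ω h) (volume_cylinder_ne_top f ω m)

theorem volume_real_cylinder_le_one (f : ℝ → ℝ) (ω : ℕ → Set ℝ) (n : ℕ) :
    volume.real (cylinder f ω n) ≤ 1 := by
  have := measureReal_mono (μ := volume) (cylinder_subset_Ico f ω n) (by simp)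
  simpa using this

theorem hasExpansion_of_mem_cylinders {f : ℝ → ℝ} {P : Set (Set ℝ)} {y : ℝ}
    (h : ∀ k, ∃ υ : ℕ → Set ℝ, (∀ i, υ i ∈ P) ∧ y ∈ cylinder f υ k) : HasExpansion f P y := by
  choose υ hυ hy using h
  exact ⟨fun i => υ (i + 1) i, (hy 0).1, fun i => ⟨hυ _ _, (hy (i + 1)).2 i i.lt_succ_self⟩⟩

theorem IsFullShiftMap.nonempty {f : ℝ → ℝ} {P : Set (Set ℝ)} (h : IsFullShiftMap f P) :
    P.Nonempty := by
  by_contra hP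
  rw [not_nonempty_iff_eq_empty] at hP
  have := h.total
  subst hP
  simp at this

/-- An itinerary of `z`, completed by arbitrary pieces where the orbit of `z` leaves the pieces. -/
theorem IsFullShiftMap.exists_itinerary {f : ℝ → ℝ} {P : Set (Set ℝ)} (h : IsFullShiftMap f P)
    (z : ℝ) : ∃ ω : ℕ → Set ℝ, (∀ i, ω i ∈ P) ∧ ∀ υ : ℕ → Set ℝ, (∀ i, υ i ∈ P) → ∀ m,
      z ∈ cylinder f υ m → cylinder f υ m = cylinder f ω m := by
  have hex : ∀ i, ∃ J ∈ P, ∀ J' ∈ P, f^[i] z ∈ J' → J' = J := by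
    intro i
    by_cases hi : ∃ J ∈ P, f^[i] z ∈ J
    · obtain ⟨J, hJ, hz⟩ := hi
      exact ⟨J, hJ, fun J' hJ' hz' => h.eq_of_mem hJ' hJ hz' hz⟩
    · obtain ⟨J, hJ⟩ := h.nonempty
      exact ⟨J, hJ, fun J' hJ' hz' => absurd ⟨J', hJ', hz'⟩ hi⟩
  choose ω hω hω' using hex
  exact ⟨ω, hω, fun υ hυ m hz => cylinder_congr f fun i hi => hω' i _ (hυ i) (hz.2 i hi)⟩

/-! ### Obstacles for a single map -/

/-- The points of the generation `m + 1` cylinder of `ω` whose `m`-th iterate enters the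
generation `n` cylinder of `Ω`. -/
def obstacle (f : ℝ → ℝ) (ω : ℕ → Set ℝ) (m : ℕ) (Ω : ℕ → Set ℝ) (n : ℕ) : Set ℝ :=
  cylinder f ω (m + 1) ∩ {y | f^[m] y ∈ cylinder f Ω n}

theorem IsFullShiftMap.obstacle_eq {f : ℝ → ℝ} {P : Set (Set ℝ)} (h : IsFullShiftMap f P)
    {ω Ω : ℕ → Set ℝ} (hω : ∀ i, ω i ∈ P) (hΩ : ∀ i, Ω i ∈ P) (m : ℕ) {n : ℕ} (hn : 1 ≤ n) :
    obstacle f ω m Ω n = ∅ ∨ ∃ τ : ℕ → Set ℝ, (∀ i, τ i ∈ P) ∧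
      obstacle f ω m Ω n = cylinder f τ (m + n) ∧
      cylinder f τ (m + 1) = cylinder f ω (m + 1) := by
  rcases eq_empty_or_nonempty (obstacle f ω m Ω n) with h0 | ⟨y, hy, hy'⟩
  · exact Or.inl h0
  right
  have heq : ω m = Ω 0 := h.eq_of_mem (hω m) (hΩ 0) (hy.2 m m.lt_succ_self) (hy'.2 0 hn)
  have hτ : cylinder f (fun i => if i < m then ω i else Ω (i - m)) (m + 1) =
      cylinder f ω (m + 1) := by
    refine cylinder_congr f fun i hi => ?_
    split_ifs with him
    · rfl
    · have : i = m := by omega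
      rw [this, Nat.sub_self, heq]
  refine ⟨fun i => if i < m then ω i else Ω (i - m), fun i => ?_, ?_, hτ⟩
  · dsimp only
    split_ifs
    · exact hω i
    · exact hΩ _
  · ext x
    constructor
    · rintro ⟨hx, hx'⟩
      refine ⟨hx.1, fun i hi => ?_⟩
      by_cases him : i < m
      · simpa [him] using hx.2 i (by omega)
      · have := hx'.2 (i - m) (by omega)
        rw [← Function.iterate_add_apply, Nat.sub_add_cancel (by omega)] at this
        simpa [him] using this
    · intro hx
      have hx1 : x ∈ cylinder f ω (m + 1) := hτ ▸ cylinder_anti f _ (by omega) hx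
      refine ⟨hx1, ?_, fun i hi => ?_⟩
      · exact (h.interval _ (hω m)).1 (hx1.2 m m.lt_succ_self)
      · have := hx.2 (m + i) (by omega)
        rw [← Function.iterate_add_apply, Nat.add_comm i m]
        simpa using this

theorem volume_real_cylinder_add_le {f : ℝ → ℝ} {g : ℕ → ℝ} {ω : ℕ → Set ℝ} {n m : ℕ}
    (h : volume.real (cylinder f ω (n + m)) / volume.real (cylinder f ω n) ≤ g m) :
    volume.real (cylinder f ω (n + m)) ≤ g m * volume.real (cylinder f ω n) := by
  rcases eq_or_lt_of_le (measureReal_nonneg (μ := volume) (s := cylinder f ω n)) with h0 | h0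
  · rw [← h0, mul_zero, h0]
    exact volume_real_cylinder_anti f ω (Nat.le_add_right n m)
  · rwa [div_le_iff₀ h0] at h

/-- The cylinders around a point whose lengths lie between `lam * l` and `l` have boundedly many
generations. -/
theorem exists_window {f : ℝ → ℝ} {P : Set (Set ℝ)} {g : ℕ → ℝ} (hg : Tendsto g atTop (𝓝 0))
    (hshrink : ∀ ω : ℕ → Set ℝ, (∀ i, ω i ∈ P) → ∀ n m : ℕ, 1 ≤ n → 1 ≤ m →
      volume.real (cylinder f ω (n + m)) / volume.real (cylinder f ω n) ≤ g m)
    {lam : ℝ} (hlam : 0 < lam) :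
    ∃ L : ℕ, ∀ ω : ℕ → Set ℝ, (∀ i, ω i ∈ P) → ∀ l : ℝ, 0 < l → ∃ M₀, 1 ≤ M₀ ∧
      volume.real (cylinder f ω M₀) ≤ l ∧ ∀ M, 1 ≤ M → volume.real (cylinder f ω M) ≤ l →
        lam * l < volume.real (cylinder f ω M) → M₀ ≤ M ∧ M < M₀ + L := by
  obtain ⟨L, hL, hL1⟩ := ((hg.eventually_lt_const hlam).and (eventually_ge_atTop 1)).exists
  refine ⟨L, fun ω hω l hl => ?_⟩
  classical
  have hex : ∃ M, 1 ≤ M ∧ volume.real (cylinder f ω M) ≤ l := by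
    obtain ⟨m, hm, hm1⟩ := ((hg.eventually_lt_const hl).and (eventually_ge_atTop 1)).exists
    refine ⟨1 + m, by omega, (volume_real_cylinder_add_le (hshrink ω hω 1 m le_rfl hm1)).trans ?_⟩
    have h0 := measureReal_nonneg (μ := volume) (s := cylinder f ω 1)
    have h1 := volume_real_cylinder_le_one f ω 1
    nlinarith
  refine ⟨Nat.find hex, (Nat.find_spec hex).1, (Nat.find_spec hex).2, fun M hM hMl hlM =>
    ⟨Nat.find_min' hex ⟨hM, hMl⟩, ?_⟩⟩
  by_contra hcon
  push Not at hcon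
  have h1 := volume_real_cylinder_anti f ω hcon
  have h2 := volume_real_cylinder_add_le (hshrink ω hω _ L (Nat.find_spec hex).1 hL1)
  have h3 := (Nat.find_spec hex).2
  have h4 := measureReal_nonneg (μ := volume) (s := cylinder f ω (Nat.find hex))
  nlinarith

theorem left_or_right_mem {p : Set ℝ} (hp : p.OrdConnected) {B : ℝ × ℝ} {y : ℝ} (hy : y ∈ p)
    (hyB : y ∈ Icc B.1 B.2) (hvol : B.2 - B.1 < volume.real p) : B.1 ∈ p ∨ B.2 ∈ p := by
  by_contra! hcon
  have hsub : p ⊆ Icc B.1 B.2 := by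
    intro w hw
    constructor
    · by_contra! hlt
      exact hcon.1 (hp.out hw hy ⟨hlt.le, hyB.1⟩)
    · by_contra! hlt
      exact hcon.2 (hp.out hy hw ⟨hyB.2, hlt.le⟩)
  have h := measureReal_mono (μ := volume) hsub (by simp)
  rw [Real.volume_real_Icc_of_le (hyB.1.trans hyB.2)] at h
  linarith

/-- The obstacles met by an interval `B` inside cylinders of length comparable to `B`. Such a
cylinder contains an endpoint of `B`, so that there are boundedly many of them, and the obstacles
take up as small a part of them as desired if `n` is large. -/
theorem exists_obstacles {f : ℝ → ℝ} {P : Set (Set ℝ)} (h : IsFullShiftMap f P)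
    (hs : CylindersShrink f P) (Ω : ℕ → Fin 3 → ℕ → Set ℝ) (hΩ : ∀ n q i, Ω n q i ∈ P)
    {lam ε : ℝ} (hlam : 0 < lam) (hε : 0 < ε) :
    ∃ n, 1 ≤ n ∧ ∀ B : ℝ × ℝ, ∃ l : List (Set ℝ), (∀ b ∈ l, b.OrdConnected ∧ b ⊆ Ico 0 1) ∧
      (B.1 < B.2 → potential B l ≤ ε ∧
        ∀ y ∈ Icc B.1 B.2, ∀ υ : ℕ → Set ℝ, (∀ i, υ i ∈ P) → ∀ m q, y ∈ cylinder f υ (m + 1) →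
          B.2 - B.1 < volume.real (cylinder f υ (m + 1)) →
          volume.real (cylinder f υ (m + 1)) ≤ (B.2 - B.1) / lam →
          f^[m] y ∈ cylinder f (Ω n q) n →
          ∃ b ∈ l, y ∈ b ∧ ∃ (τ : ℕ → Set ℝ) (N : ℕ), (∀ i, τ i ∈ P) ∧ b = cylinder f τ N) := by
  obtain ⟨g, hg, hshrink⟩ := hs
  obtain ⟨L, hL⟩ := exists_window hg hshrink hlam
  have hlim : Tendsto (fun m => (2 * (L * 3) : ℝ) * √(g m / lam)) atTop (𝓝 0) := by
    have h1 := (Real.continuous_sqrt.tendsto _).comp (hg.div_const lam)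
    have h2 := h1.const_mul (2 * (L * 3) : ℝ)
    simpa using h2
  obtain ⟨m, hm, hm1⟩ := ((hlim.eventually_lt_const hε).and (eventually_ge_atTop 1)).exists
  refine ⟨m + 1, by omega, fun B => ?_⟩
  by_cases hB : B.1 < B.2
  swap
  · exact ⟨[], by simp, fun h => absurd h hB⟩
  have hB0 : 0 < B.2 - B.1 := sub_pos.2 hB
  choose itin hitin hitin' using h.exists_itinerary
  have hwin := fun z => hL (itin z) (hitin z) ((B.2 - B.1) / lam) (by positivity)
  choose M₀ hM₀ hM₀l hM₀' using hwin
  let z : Bool → ℝ := fun s => if s then B.2 else B.1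
  let ob : Bool × Fin L × Fin 3 → Set ℝ := fun p =>
    obstacle f (itin (z p.1)) (M₀ (z p.1) + p.2.1 - 1) (Ω (m + 1) p.2.2) (m + 1)
  have hob := fun p : Bool × Fin L × Fin 3 => h.obstacle_eq (hitin (z p.1)) (hΩ (m + 1) p.2.2)
    (M₀ (z p.1) + p.2.1 - 1) (n := m + 1) (by omega)
  have hg0 : 0 ≤ g m := by
    refine le_trans ?_ (hshrink (itin 0) (hitin 0) 1 m le_rfl hm1)
    positivity
  have hvol : ∀ p, volume.real (ob p) ≤ g m * ((B.2 - B.1) / lam) := by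
    intro p
    rcases hob p with h0 | ⟨τ, hτ, h1, h2⟩
    · simp only [ob, h0]
      simp only [measureReal_empty]
      positivity
    · have h3 := volume_real_cylinder_add_le (hshrink τ hτ (M₀ (z p.1) + p.2.1 - 1 + 1) m
        (by omega) hm1)
      simp only [ob, h1]
      rw [show M₀ (z p.1) + p.2.1 - 1 + (m + 1) = M₀ (z p.1) + p.2.1 - 1 + 1 + m by omega]
      refine h3.trans (mul_le_mul_of_nonneg_left ?_ hg0)
      rw [h2]
      refine (volume_real_cylinder_anti f _ ?_).trans (hM₀l (z p.1))
      omega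
  refine ⟨Finset.univ.toList.map ob, ?_, fun _ => ⟨?_, ?_⟩⟩
  · intro b hb
    obtain ⟨p, -, rfl⟩ := List.mem_map.1 hb
    rcases hob p with h0 | ⟨τ, hτ, h1, -⟩
    · simp only [ob, h0]
      exact ⟨ordConnected_empty, empty_subset _⟩
    · simp only [ob, h1]
      exact ⟨h.ordConnected_cylinder hτ _, cylinder_subset_Ico _ _ _⟩
  · refine le_trans ?_ hm.le
    have hw : ∀ x ∈ (Finset.univ.toList.map ob).map (weight B), x ≤ √(g m / lam) := by
      intro x hx
      obtain ⟨b, hb, rfl⟩ := List.mem_map.1 hx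
      obtain ⟨p, -, rfl⟩ := List.mem_map.1 hb
      refine (weight_le _ _).trans (Real.sqrt_le_sqrt ?_)
      rw [div_le_iff₀ hB0]
      refine (hvol p).trans (le_of_eq ?_)
      ring
    refine (List.sum_le_card_nsmul _ _ hw).trans (le_of_eq ?_)
    simp
  · intro y hy υ hυ k q hyυ h1 h2 h3
    have hz : ∃ s, z s ∈ cylinder f υ (k + 1) := by
      rcases left_or_right_mem (h.ordConnected_cylinder hυ _) hyυ hy h1 with hz | hz
      · exact ⟨false, hz⟩
      · exact ⟨true, hz⟩
    obtain ⟨s, hz⟩ := hz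
    have heq := hitin' _ υ hυ _ hz
    rw [heq] at h1 h2 hyυ
    obtain ⟨h4, h5⟩ := hM₀' (z s) (k + 1) (by omega) h2 (by
      rw [mul_div_cancel₀ _ hlam.ne']; exact h1)
    have hk : M₀ (z s) + (k + 1 - M₀ (z s)) - 1 = k := by omega
    have hyob : y ∈ ob (s, ⟨k + 1 - M₀ (z s), by omega⟩, q) := by
      simp only [ob]
      rw [hk]
      exact ⟨hyυ, h3⟩
    refine ⟨_, List.mem_map_of_mem (Finset.mem_toList.2 (Finset.mem_univ _)), hyob, ?_⟩
    rcases hob (s, ⟨k + 1 - M₀ (z s), by omega⟩, q) with h0 | ⟨τ, hτ, h6, -⟩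
    · simp only [ob] at hyob
      rw [h0] at hyob
      exact absurd hyob (notMem_empty _)
    · exact ⟨τ, _, hτ, h6⟩

/-! ### Full dimension for countably many maps -/

theorem potential_flatMap_range (B : ℝ × ℝ) (l : ℕ → List (Set ℝ)) (k : ℕ) :
    potential B ((List.range k).flatMap l) = ∑ i ∈ Finset.range k, potential B (l i) := by
  induction k with
  | zero => simp [potential]
  | succ k ih =>
    rw [List.range_succ, List.flatMap_append, potential_append, ih, Finset.sum_range_succ]
    simp

theorem tendsto_log_div_log {α : ℝ} (hα : 0 < α) :
    Tendsto (fun K : ℕ => Real.log K / Real.log (α * (1 / (4 * K)))⁻¹) atTop (𝓝 1) := by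
  have hlog : Tendsto (fun K : ℕ => Real.log K) atTop atTop :=
    Real.tendsto_log_atTop.comp tendsto_natCast_atTop_atTop
  have h1 : Tendsto (fun K : ℕ => 1 - Real.log (4 / α) / (Real.log K + Real.log (4 / α)))
      atTop (𝓝 (1 - 0)) :=
    tendsto_const_nhds.sub ((tendsto_atTop_add_const_right _ _ hlog).const_div_atTop _)
  rw [sub_zero] at h1
  refine h1.congr' ?_
  filter_upwards [eventually_ge_atTop 1,
    (tendsto_atTop_add_const_right _ (Real.log (4 / α)) hlog).eventually_gt_atTop 0] with K hK hpos
  have hK0 : (0 : ℝ) < K := by exact_mod_cast hK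
  have : (α * (1 / (4 * (K : ℝ))))⁻¹ = K * (4 / α) := by field_simp
  rw [this, Real.log_mul hK0.ne' (by positivity)]
  field_simp
  ring

/-- The bound on the dimension for a fixed `K`: the orbits under each map `f i` that never enter
the three generation `n` cylinders prescribed for some `n`. -/
theorem le_dimH_avoiding {α : ℝ} (hα : 0 < α) (hα1 : α < 1) {f : ℕ → ℝ → ℝ}
    {P : ℕ → Set (Set ℝ)} (hf : ∀ i, Admissible α (f i) (P i))
    (Ω : ℕ → ℕ → Fin 3 → ℕ → Set ℝ) (hΩ : ∀ i n q j, Ω i n q j ∈ P i)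
    {K : ℕ} (hK : 16 / α ≤ K) :
    ENNReal.ofReal (Real.log K / Real.log (α * (1 / (4 * K)))⁻¹) ≤
      dimH {y : ℝ | ∀ i, HasExpansion (f i) (P i) y ∧
        ∃ n, 1 ≤ n ∧ ∀ m q, (f i)^[m] y ∉ cylinder (f i) (Ω i n q) n} := by
  have hK0 : (0 : ℝ) < K := lt_of_lt_of_le (by positivity) hK
  have hK16 : (16 : ℝ) ≤ K := by
    refine le_trans ?_ hK
    rw [le_div_iff₀ hα]; linarith
  obtain ⟨ρ, hρ⟩ : ∃ ρ : ℝ, ρ = α * (1 / (4 * K)) := ⟨_, rfl⟩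
  have hρ0 : 0 < ρ := by rw [hρ]; positivity
  have hβ1 : 1 / (4 * (K : ℝ)) < 1 := by
    rw [div_lt_one (by positivity)]; linarith
  have hρ1 : ρ < 1 := by
    calc ρ ≤ α * 1 := by rw [hρ]; gcongr
      _ < 1 := by linarith
  -- For `f i` obstacles are announced from round `i` on, when Black's interval has length
  -- `ρ ^ i / 2`. The choice of `lam` lets this first round deal with all long cylinders.
  have hobs := fun i => exists_obstacles (hf i).fullShift (hf i).shrink (Ω i) (hΩ i)
    (lam := ρ ^ (i + 1) / 2) (ε := ρ / 2 * (1 / 2) ^ (i + 1)) (by positivity) (by positivity)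
  choose n hn l hl hl' using hobs
  let newBad : ℕ → ℝ × ℝ → List (Set ℝ) := fun t B => (List.range (t + 1)).flatMap fun i => l i B
  let T : ℕ → Set ℝ → Prop := fun j W =>
    ∃ C, IsCylinder (f j.unpair.1) (P j.unpair.1) j.unpair.2 C ∧ W ⊆ C
  have hT : ∀ j u v, 0 ≤ u → u < v → v < 1 → WhiteCanReach α (1 / (4 * K)) (u, v) (T j) :=
    fun j u v h0 huv hv =>
      (hf j.unpair.1).enter j.unpair.2 u v h0 huv hv _ (by positivity) hβ1
  have hmain := le_dimH_of_targets_of_obstacles hα hα1 hK hρ T hT newBad ?_ ?_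
  · rw [← hρ]
    refine hmain.trans (dimH_mono ?_)
    rintro y ⟨B, hB, hreach, havoid⟩ i
    -- all cylinders around `y` have positive length, as White has entered them
    have hcyl : ∀ k, ∃ υ : ℕ → Set ℝ, (∀ j, υ j ∈ P i) ∧ y ∈ cylinder (f i) υ k ∧
        0 < volume.real (cylinder (f i) υ k) := by
      intro k
      obtain ⟨W, hW, hyW, hTW⟩ := hreach (Nat.pair i k)
      simp only [T, Nat.unpair_pair] at hTW
      obtain ⟨C, ⟨υ, hυ, rfl⟩, hWC⟩ := hTW
      refine ⟨υ, hυ, hWC hyW, ?_⟩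
      have h1 := measureReal_mono (μ := volume) hWC (volume_cylinder_ne_top _ _ _)
      rw [Real.volume_real_Icc_of_le hW.le] at h1
      linarith
    refine ⟨hasExpansion_of_mem_cylinders fun k => ?_, n i, hn i, fun m q hq => ?_⟩
    · obtain ⟨υ, hυ, hy, -⟩ := hcyl k
      exact ⟨υ, hυ, hy⟩
    obtain ⟨υ, hυ, hy, hpos⟩ := hcyl (m + 1)
    have hround : ∃ t, i ≤ t ∧ ρ ^ t / 2 < volume.real (cylinder (f i) υ (m + 1)) ∧
        volume.real (cylinder (f i) υ (m + 1)) ≤ ρ ^ t / 2 / (ρ ^ (i + 1) / 2) := by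
      classical
      have hex : ∃ s, ρ ^ (i + s) / 2 < volume.real (cylinder (f i) υ (m + 1)) := by
        obtain ⟨s, hs⟩ := exists_pow_lt_of_lt_one hpos hρ1
        refine ⟨s, lt_of_le_of_lt ?_ hs⟩
        have h1 : ρ ^ (i + s) ≤ ρ ^ s := pow_le_pow_of_le_one hρ0.le hρ1.le (by omega)
        have h2 : 0 < ρ ^ s := by positivity
        linarith
      refine ⟨i + Nat.find hex, by omega, Nat.find_spec hex, ?_⟩
      rcases Nat.eq_zero_or_pos (Nat.find hex) with h0 | h0
      · rw [h0, add_zero, le_div_iff₀ (by positivity)]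
        have h1 := volume_real_cylinder_le_one (f i) υ (m + 1)
        have h2 : ρ ^ (i + 1) ≤ ρ ^ i := pow_le_pow_of_le_one hρ0.le hρ1.le (by omega)
        have h3 : 0 < ρ ^ (i + 1) := by positivity
        nlinarith
      · obtain ⟨s, hs⟩ : ∃ s, Nat.find hex = s + 1 := ⟨_, (Nat.succ_pred_eq_of_pos h0).symm⟩
        have h1 := Nat.find_min hex (m := s) (by omega)
        rw [not_lt] at h1
        rw [hs]
        refine h1.trans ?_
        rw [le_div_iff₀ (by positivity)]
        have h2 : ρ ^ (i + (s + 1)) = ρ ^ (i + s) * ρ := by rw [← pow_succ]; rfl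
        have h3 : ρ ^ (i + 1) ≤ ρ ^ 1 := pow_le_pow_of_le_one hρ0.le hρ1.le (by omega)
        have h4 : 0 < ρ ^ (i + s) := by positivity
        rw [h2]
        rw [pow_one] at h3
        nlinarith
    obtain ⟨t, hit, ht1, ht2⟩ := hround
    obtain ⟨hlen, hyB⟩ := hB t
    have hBt : (B t).1 < (B t).2 := by
      have : 0 < ρ ^ t / 2 := by positivity
      linarith
    obtain ⟨b, hb, hyb, τ, N, hτ, rfl⟩ := (hl' i (B t) hBt).2 y hyB υ hυ m q hy
      (by rw [hlen]; exact ht1) (by rw [hlen]; exact ht2) hq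
    have h0 := havoid t _ (List.mem_flatMap.2 ⟨i, List.mem_range.2 (by omega), hb⟩) hyb
    obtain ⟨υ', hυ', hy', hpos'⟩ := hcyl N
    rw [cylinder_congr (f i) ((hf i).fullShift.eq_of_mem_cylinder hυ' hτ hy' hyb)] at hpos'
    linarith
  · intro t B b hb
    obtain ⟨i, -, hb⟩ := List.mem_flatMap.1 hb
    exact hl i B b hb
  · intro t B hB
    have hB' : B.1 < B.2 := by
      have : 0 < ρ ^ t / 2 := by positivity
      linarith
    simp only [newBad]
    rw [potential_flatMap_range]
    calc ∑ i ∈ Finset.range (t + 1), potential B (l i B)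
        ≤ ∑ i ∈ Finset.range (t + 1), ρ / 2 * (1 / 2) ^ (i + 1) :=
          Finset.sum_le_sum fun i _ => (hl' i B hB').1
      _ = ρ / 2 * (1 / 2) * ∑ i ∈ Finset.range (t + 1), (1 / 2 : ℝ) ^ i := by
          rw [Finset.mul_sum]
          exact Finset.sum_congr rfl fun i _ => by ring
      _ ≤ ρ / 2 * (1 / 2) * 2 := by
          gcongr
          exact sum_geometric_two_le _
      _ = ρ / 2 := by ring

theorem dimH_avoiding {α : ℝ} (hα : 0 < α) (hα1 : α < 1) {f : ℕ → ℝ → ℝ}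
    {P : ℕ → Set (Set ℝ)} (hf : ∀ i, Admissible α (f i) (P i))
    (Ω : ℕ → ℕ → Fin 3 → ℕ → Set ℝ) (hΩ : ∀ i n q j, Ω i n q j ∈ P i) :
    1 ≤ dimH {y : ℝ | ∀ i, HasExpansion (f i) (P i) y ∧
        ∃ n, 1 ≤ n ∧ ∀ m q, (f i)^[m] y ∉ cylinder (f i) (Ω i n q) n} := by
  have h := ENNReal.tendsto_ofReal (tendsto_log_div_log hα)
  rw [ENNReal.ofReal_one] at h
  refine le_of_tendsto h ?_
  filter_upwards [eventually_ge_atTop ⌈16 / α⌉₊] with K hK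
  exact le_dimH_avoiding hα hα1 hf Ω hΩ (Nat.ceil_le.1 hK)

theorem dimH_eq_one {s : Set ℝ} (h : 1 ≤ dimH s) : dimH s = 1 :=
  le_antisymm ((dimH_mono (subset_univ s)).trans Real.dimH_univ.le) h

theorem mem_symbolicG {f : ℝ → ℝ} {P : Set (Set ℝ)} (hf : IsFullShiftMap f P) {x y : ℝ}
    {ω : ℕ → Set ℝ} (hω : IsExpansion f P x ω) (hy : HasExpansion f P y) {n : ℕ} (hn : 1 ≤ n)
    (h : ∀ m, f^[m] y ∉ cylinder f ω n) : y ∈ symbolicG f P x := by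
  obtain ⟨υ, hυ⟩ := hy
  refine ⟨ω, υ, hω, hυ, n, hn, fun k => ?_⟩
  by_contra! hcon
  refine h k ⟨(hf.interval _ (hυ.2 k).1).1 (hυ.2 k).2, fun i hi => ?_⟩
  rw [← hcon i hi, ← Function.iterate_add_apply, Nat.add_comm i k]
  exact (hυ.2 (k + i)).2

theorem mem_G {f : ℝ → ℝ} {P : Set (Set ℝ)} (hf : IsFullShiftMap f P) {x y : ℝ}
    (hy : HasExpansion f P y) {n : ℕ} {Ω : Fin 3 → ℕ → Set ℝ}
    (hΩ : (⋃ q, cylinder f (Ω q) n) ∈ 𝓝[Ico (0 : ℝ) 1] x)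
    (h : ∀ m q, f^[m] y ∉ cylinder f (Ω q) n) : y ∈ G f P x := by
  refine ⟨hy, fun hcl => ?_⟩
  obtain ⟨υ, hυ⟩ := hy
  obtain ⟨U, hU, hUsub⟩ := mem_nhdsWithin_iff_exists_mem_nhds_inter.1 hΩ
  obtain ⟨_, hmU, m, rfl⟩ := mem_closure_iff_nhds.1 hcl U hU
  obtain ⟨q, hq⟩ := mem_iUnion.1 (hUsub ⟨hmU, (hf.interval _ (hυ.2 m).1).1 (hυ.2 m).2⟩)
  exact h m q hq

/-- On one side of `x`, a single member of a finite family of intervals is left. -/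
theorem exists_mem_nhdsWithin_of_finite {F : Set (Set ℝ)} (hF : F.Finite)
    (hord : ∀ C ∈ F, C.OrdConnected) (hne : F.Nonempty) {S : Set ℝ} {x : ℝ}
    (hS : ∀ z₀ ∈ S, ∀ᶠ z in 𝓝[S] x, ∀ᶠ z₁ in 𝓝[S] x, z ∈ uIcc z₁ z₀)
    (hFS : ⋃₀ F ∈ 𝓝[S] x) : ∃ C ∈ F, C ∈ 𝓝[S] x := by
  rcases eq_or_neBot (𝓝[S] x) with hbot | hbot
  · obtain ⟨C, hC⟩ := hne
    exact ⟨C, hC, by rw [hbot]; exact mem_bot⟩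
  have hfreq : ∃ C ∈ F, ∃ᶠ z in 𝓝[S] x, z ∈ C := by
    by_contra! hcon
    have h1 : ∀ᶠ z in 𝓝[S] x, ∀ C ∈ F, z ∉ C :=
      (eventually_all_finite hF).2 fun C hC => hcon C hC
    obtain ⟨z, hz, C, hC, hzC⟩ := (h1.and hFS).exists
    exact hz C hC hzC
  obtain ⟨C, hC, hfreq⟩ := hfreq
  refine ⟨C, hC, ?_⟩
  obtain ⟨z₀, hz₀C, hz₀⟩ := (hfreq.and_eventually self_mem_nhdsWithin).exists
  filter_upwards [hS z₀ hz₀] with z hz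
  obtain ⟨z₁, hz₁C, hz₁⟩ := (hfreq.and_eventually hz).exists
  exact (hord C hC).uIcc_subset hz₁C hz₀C hz₁

theorem LocallyFiniteAt.exists_three {f : ℝ → ℝ} {P : Set (Set ℝ)} (hf : IsFullShiftMap f P)
    {x : ℝ} (hx : x ∈ Ico (0 : ℝ) 1) (h : LocallyFiniteAt f P x) (n : ℕ) :
    ∃ Ω : Fin 3 → ℕ → Set ℝ, (∀ q i, Ω q i ∈ P) ∧
      (⋃ q, cylinder f (Ω q) n) ∈ 𝓝[Ico (0 : ℝ) 1] x := by
  obtain ⟨F, hF, hcyl, hnhds⟩ := h n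
  have hord : ∀ C ∈ F, C.OrdConnected := by
    intro C hC
    obtain ⟨ω, hω, rfl⟩ := hcyl C hC
    exact hf.ordConnected_cylinder hω n
  obtain ⟨C₀, hC₀, hxC₀⟩ := mem_sUnion.1 (mem_of_mem_nhdsWithin hx hnhds)
  have hr : ∃ C ∈ F, C ∈ 𝓝[Ico (0 : ℝ) 1 ∩ Ioi x] x := by
    refine exists_mem_nhdsWithin_of_finite hF hord ⟨C₀, hC₀⟩ ?_
      (nhdsWithin_mono _ inter_subset_left hnhds)
    intro z₀ hz₀
    filter_upwards [self_mem_nhdsWithin, mem_nhdsWithin_of_mem_nhds (Iio_mem_nhds hz₀.2)]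
      with z hz hzz₀
    filter_upwards [mem_nhdsWithin_of_mem_nhds (Iio_mem_nhds hz.2)] with z₁ hz₁
    exact mem_uIcc.2 (Or.inl ⟨(mem_Iio.1 hz₁).le, (mem_Iio.1 hzz₀).le⟩)
  have hl : ∃ C ∈ F, C ∈ 𝓝[Ico (0 : ℝ) 1 ∩ Iio x] x := by
    refine exists_mem_nhdsWithin_of_finite hF hord ⟨C₀, hC₀⟩ ?_
      (nhdsWithin_mono _ inter_subset_left hnhds)
    intro z₀ hz₀
    filter_upwards [self_mem_nhdsWithin, mem_nhdsWithin_of_mem_nhds (Ioi_mem_nhds hz₀.2)]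
      with z hz hzz₀
    filter_upwards [mem_nhdsWithin_of_mem_nhds (Ioi_mem_nhds hz.2)] with z₁ hz₁
    exact mem_uIcc.2 (Or.inr ⟨(mem_Ioi.1 hzz₀).le, (mem_Ioi.1 hz₁).le⟩)
  obtain ⟨Cr, hCr, hr⟩ := hr
  obtain ⟨Cl, hCl, hl⟩ := hl
  obtain ⟨ω₀, hω₀, rfl⟩ := hcyl _ hC₀
  obtain ⟨ωr, hωr, rfl⟩ := hcyl _ hCr
  obtain ⟨ωl, hωl, rfl⟩ := hcyl _ hCl
  refine ⟨![ω₀, ωr, ωl], ?_, ?_⟩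
  · intro q i
    fin_cases q
    · exact hω₀ i
    · exact hωr i
    · exact hωl i
  have hsplit : Ico (0 : ℝ) 1 = (Ico 0 1 ∩ Iio x) ∪ ({x} ∪ (Ico 0 1 ∩ Ioi x)) := by
    ext z
    constructor
    · intro hz
      rcases lt_trichotomy z x with h | h | h
      · exact Or.inl ⟨hz, h⟩
      · exact Or.inr (Or.inl h)
      · exact Or.inr (Or.inr ⟨hz, h⟩)
    · rintro (hz | hz | hz)
      · exact hz.1
      · rw [mem_singleton_iff.1 hz]; exact hx
      · exact hz.1
  rw [hsplit, nhdsWithin_union, nhdsWithin_union, nhdsWithin_singleton]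
  refine mem_sup.2 ⟨mem_of_superset hl ?_, mem_sup.2 ⟨?_, mem_of_superset hr ?_⟩⟩
  · exact subset_iUnion_of_subset 2 subset_rfl
  · exact mem_iUnion.2 ⟨0, hxC₀⟩
  · exact subset_iUnion_of_subset 1 subset_rfl

theorem dimH_iInter_symbolicG {α : ℝ} (hα : 0 < α) (hα1 : α < 1) {f : ℕ → ℝ → ℝ}
    {P : ℕ → Set (Set ℝ)} (hf : ∀ i, Admissible α (f i) (P i)) {x : ℕ → ℝ}
    (hx : ∀ i, HasExpansion (f i) (P i) (x i)) :
    dimH (⋂ i, symbolicG (f i) (P i) (x i)) = 1 := by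
  choose ω hω using hx
  refine dimH_eq_one ((dimH_avoiding hα hα1 hf (fun i _ _ => ω i)
    fun i _ _ j => ((hω i).2 j).1).trans (dimH_mono fun y hy => mem_iInter.2 fun i => ?_))
  obtain ⟨hexp, n, hn, h⟩ := hy i
  exact mem_symbolicG (hf i).fullShift (hω i) hexp hn fun m => h m 0

theorem dimH_iInter_G {α : ℝ} (hα : 0 < α) (hα1 : α < 1) {f : ℕ → ℝ → ℝ}
    {P : ℕ → Set (Set ℝ)} (hf : ∀ i, Admissible α (f i) (P i)) {x : ℕ → ℝ}
    (hx : ∀ i, x i ∈ Ico (0 : ℝ) 1) (hfin : ∀ i, LocallyFiniteAt (f i) (P i) (x i)) :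
    dimH (⋂ i, G (f i) (P i) (x i)) = 1 := by
  have hthree := fun i n => (hfin i).exists_three (hf i).fullShift (hx i) n
  choose Ω hΩ hΩ' using hthree
  refine dimH_eq_one ((dimH_avoiding hα hα1 hf Ω hΩ).trans
    (dimH_mono fun y hy => mem_iInter.2 fun i => ?_))
  obtain ⟨hexp, n, -, h⟩ := hy i
  exact mem_G (hf i).fullShift hexp (hΩ' i n) h

/-! ### Entering cylinders by avoiding a countable set -/

/-- White's half-sided answer to `B`, on the side where the point `x` is not. -/
noncomputable def dodge (α : ℝ) (B : ℝ × ℝ) (x : ℝ) : ℝ × ℝ :=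
  if (B.1 + B.2) / 2 ≤ x then (B.1, B.1 + α * (B.2 - B.1)) else (B.2 - α * (B.2 - B.1), B.2)

theorem isMove_dodge {α : ℝ} (hα : 0 < α) (hα1 : α ≤ 1 / 2) {B : ℝ × ℝ} (hB : B.1 < B.2) (x : ℝ) :
    IsMove α B (dodge α B x) := by
  have hd : 0 < B.2 - B.1 := sub_pos.2 hB
  have h1 : 0 < α * (B.2 - B.1) := mul_pos hα hd
  have h2 : α * (B.2 - B.1) ≤ 1 / 2 * (B.2 - B.1) := mul_le_mul_of_nonneg_right hα1 hd.le
  unfold dodge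
  split_ifs
  · exact ⟨Icc_subset_Icc le_rfl (by simp only; linarith), by simp only; linarith,
      by simp only; ring⟩
  · exact ⟨Icc_subset_Icc (by simp only; linarith) le_rfl, by simp only; linarith,
      by simp only; ring⟩

/-- White gets rid of a point in two moves (for `α = 1/2` one move may leave it as an endpoint). -/
theorem notMem_dodge_dodge {α : ℝ} (hα1 : α ≤ 1 / 2) {B B' : ℝ × ℝ} (hB : B.1 < B.2)
    (hB' : B'.1 < B'.2) {x : ℝ}
    (hsub : Icc B'.1 B'.2 ⊆ Icc (dodge α B x).1 (dodge α B x).2) :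
    x ∉ Icc (dodge α B' x).1 (dodge α B' x).2 := by
  have hd : 0 < B.2 - B.1 := sub_pos.2 hB
  have hd' : 0 < B'.2 - B'.1 := sub_pos.2 hB'
  have h2 : α * (B.2 - B.1) ≤ 1 / 2 * (B.2 - B.1) := mul_le_mul_of_nonneg_right hα1 hd.le
  have h2' : α * (B'.2 - B'.1) ≤ 1 / 2 * (B'.2 - B'.1) := mul_le_mul_of_nonneg_right hα1 hd'.le
  have hl := hsub (left_mem_Icc.2 hB'.le)
  have hr := hsub (right_mem_Icc.2 hB'.le)
  intro hx
  unfold dodge at hl hr hx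
  split_ifs at hl hr hx with h3 h4 h4 <;> simp only [mem_Icc] at hl hr hx <;> linarith

theorem whiteCanReach_of_countable {α β : ℝ} (hα : 0 < α) (hα1 : α ≤ 1 / 2) (hβ : 0 < β)
    (hβ1 : β < 1) {I : ℝ × ℝ} (hI : I.1 < I.2) {X : Set ℝ} (hX : X.Countable)
    {T : Set ℝ → Prop}
    (hT : ∀ y ∈ Icc I.1 I.2, y ∉ X → ∃ U ∈ 𝓝 y, ∀ W, W ⊆ U → T W) :
    WhiteCanReach α β I T := by
  obtain ⟨e, he⟩ := countable_iff_exists_subset_range.1 hX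
  let σ : List (ℝ × ℝ) → ℝ × ℝ := fun l => dodge α (l.getLastD (0, 0)) (e ((l.length - 1) / 2))
  have hσ : ∀ B k, white σ B k = dodge α (B k) (e (k / 2)) := by
    intro B k
    simp [white, σ, List.range_succ]
  have hpos : ∀ B : ℕ → ℝ × ℝ, B 0 = I → ∀ k, (∀ j < k, IsMove β (white σ B j) (B (j + 1))) →
      (B k).1 < (B k).2 := by
    intro B hB0 k hk
    cases k with
    | zero => rw [hB0]; exact hI
    | succ k => exact (hk k k.lt_succ_self).2.1
  refine ⟨σ, fun B hB0 k hk => ?_, fun B hB0 hB => ?_⟩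
  · rw [hσ]
    exact isMove_dodge hα hα1 (hpos B hB0 k hk) _
  have hpos' : ∀ k, (B k).1 < (B k).2 := fun k => hpos B hB0 k fun j _ => hB j
  have hW : ∀ k, IsMove α (B k) (white σ B k) := fun k => by
    rw [hσ]; exact isMove_dodge hα hα1 (hpos' k) _
  have hlen : ∀ k, (B k).2 - (B k).1 = (α * β) ^ k * (I.2 - I.1) := by
    intro k
    induction k with
    | zero => rw [hB0]; simp
    | succ k ih => rw [(hB k).2.2, (hW k).2.2, ih]; ring
  have hsub : ∀ k, Icc (B (k + 1)).1 (B (k + 1)).2 ⊆ Icc (B k).1 (B k).2 :=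
    fun k => (hB k).1.trans (hW k).1
  obtain ⟨y, hy⟩ := IsCompact.nonempty_iInter_of_sequence_nonempty_isCompact_isClosed
    (fun k => Icc (B k).1 (B k).2) hsub (fun k => nonempty_Icc.2 (hpos' k).le) isCompact_Icc
    fun k => isClosed_Icc
  rw [mem_iInter] at hy
  have hyX : y ∉ X := by
    intro hyX
    obtain ⟨s, rfl⟩ := he hyX
    refine notMem_dodge_dodge hα1 (hpos' (2 * s)) (hpos' (2 * s + 1)) (x := e s) ?_ ?_
    · have := (hB (2 * s)).1
      rwa [hσ, Nat.mul_div_cancel_left s two_pos] at this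
    · have := (hB (2 * s + 1)).1 (hy (2 * s + 1 + 1))
      rwa [hσ, show (2 * s + 1) / 2 = s by omega] at this
  have hyI := hy 0
  rw [hB0] at hyI
  obtain ⟨U, hU, hUT⟩ := hT y hyI hyX
  obtain ⟨ε, hε, hεU⟩ := Metric.mem_nhds_iff.1 hU
  have hαβ : α * β < 1 := by nlinarith
  have hlim : Tendsto (fun k => (α * β) ^ k * (I.2 - I.1)) atTop (𝓝 (0 * (I.2 - I.1))) :=
    (tendsto_pow_atTop_nhds_zero_of_lt_one (by positivity) hαβ).mul_const _
  rw [zero_mul] at hlim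
  obtain ⟨k, hk⟩ := (hlim.eventually_lt_const hε).exists
  refine ⟨k, hUT _ fun z hz => hεU ?_⟩
  have h1 := (hW k).1 hz
  have h2 := hy k
  rw [← hlen] at hk
  rw [Metric.mem_ball, Real.dist_eq, abs_lt]
  constructor <;> linarith [h1.1, h1.2, h2.1, h2.2]

/-- The points outside the interiors of the cylinders of generation `k`, up to the point `0`, which
is needed as `[0,1)` is not a neighbourhood of it. -/
def exceptional (f : ℝ → ℝ) (P : Set (Set ℝ)) : ℕ → Set ℝ
  | 0 => {0}
  | k + 1 => (Ico 0 1 \ ⋃ J ∈ P, interior J) ∪ ⋃ J ∈ P, {y | y ∈ J ∧ f y ∈ exceptional f P k}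

theorem IsFullShiftMap.injOn {f : ℝ → ℝ} {P : Set (Set ℝ)} (h : IsFullShiftMap f P)
    {J : Set ℝ} (hJ : J ∈ P) : InjOn f J := by
  intro x hx y hy hxy
  have := h.expanding J hJ x hx y hy
  rw [hxy, sub_self, abs_zero] at this
  exact sub_eq_zero.1 (abs_nonpos_iff.1 this)

theorem IsFullShiftMap.countable_exceptional {f : ℝ → ℝ} {P : Set (Set ℝ)}
    (h : IsFullShiftMap f P) (hc : (Ico (0 : ℝ) 1 \ ⋃ J ∈ P, interior J).Countable) (k : ℕ) :
    (exceptional f P k).Countable := by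
  induction k with
  | zero => exact countable_singleton 0
  | succ k ih =>
    refine hc.union (h.countable.biUnion fun J hJ => ?_)
    exact MapsTo.countable_of_injOn (f := f) (fun y hy => hy.2)
      ((h.injOn hJ).mono fun y hy => hy.1) ih

theorem IsFullShiftMap.exists_cylinder_mem_nhds {f : ℝ → ℝ} {P : Set (Set ℝ)}
    (h : IsFullShiftMap f P) (hcont : ∀ J ∈ P, ∀ x ∈ interior J, ContinuousAt f x) {k : ℕ} {y : ℝ}
    (hy : y ∈ Ico (0 : ℝ) 1) (hyk : y ∉ exceptional f P k) :
    ∃ ω : ℕ → Set ℝ, (∀ i, ω i ∈ P) ∧ cylinder f ω k ∈ 𝓝 y := by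
  induction k generalizing y with
  | zero =>
    obtain ⟨J, hJ⟩ := h.nonempty
    refine ⟨fun _ => J, fun _ => hJ, ?_⟩
    have hy0 : y ≠ 0 := hyk
    filter_upwards [Ico_mem_nhds (lt_of_le_of_ne hy.1 hy0.symm) hy.2] with z hz
    exact ⟨hz, by simp⟩
  | succ k ih =>
    simp only [exceptional, mem_union, not_or, Set.mem_sdiff, not_and, not_not] at hyk
    obtain ⟨h1, h2⟩ := hyk
    obtain ⟨J, hJ, hyJ⟩ := mem_iUnion₂.1 (h1 hy)
    have hyJ' : y ∈ J := interior_subset hyJ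
    have hfy : f y ∉ exceptional f P k := fun hcon => h2 (mem_iUnion₂.2 ⟨J, hJ, hyJ', hcon⟩)
    obtain ⟨ω, hω, hnhds⟩ := ih ((h.onto J hJ).2 (mem_image_of_mem f hyJ')) hfy
    let υ : ℕ → Set ℝ := fun i => Nat.casesOn i J ω
    have hυ : υ 0 ∈ P := hJ
    refine ⟨υ, fun i => ?_, ?_⟩
    · cases i with
      | zero => exact hJ
      | succ i => exact hω i
    · filter_upwards [mem_interior_iff_mem_nhds.1 hyJ, hcont J hJ y hyJ hnhds] with z hz hz'
      exact (h.mem_cylinder_succ hυ).2 ⟨hz, hz'⟩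

theorem IsFullShiftMap.canEnterCylinders {f : ℝ → ℝ} {P : Set (Set ℝ)}
    (h : IsFullShiftMap f P) (hcont : ∀ J ∈ P, ∀ x ∈ interior J, ContinuousAt f x)
    (hc : (Ico (0 : ℝ) 1 \ ⋃ J ∈ P, interior J).Countable) {α : ℝ} (hα : 0 < α)
    (hα1 : α ≤ 1 / 2) : CanEnterCylinders α f P := by
  intro k u v hu huv hv β hβ hβ1
  refine whiteCanReach_of_countable hα hα1 hβ hβ1 huv (h.countable_exceptional hc k) ?_
  intro y hy hyk
  obtain ⟨ω, hω, hnhds⟩ :=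
    h.exists_cylinder_mem_nhds hcont ⟨hu.trans hy.1, hy.2.trans_lt hv⟩ hyk
  exact ⟨_, hnhds, fun W hW => ⟨_, ⟨ω, hω, rfl⟩, hW⟩⟩

/-! ### Shrinking of cylinders for Möbius branches -/

theorem IsFullShiftMap.exists_iterate_eq {f : ℝ → ℝ} {P : Set (Set ℝ)} (h : IsFullShiftMap f P)
    (h0 : f 0 = 0) {ω : ℕ → Set ℝ} (hω : ∀ i, ω i ∈ P) (n : ℕ) {s : ℝ} (hs : s ∈ Ioo (0 : ℝ) 1) :
    ∃ x ∈ cylinder f ω n, x ∈ Ioo (0 : ℝ) 1 ∧ f^[n] x = s := by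
  induction n generalizing ω with
  | zero => exact ⟨s, ⟨Ioo_subset_Ico_self hs, by simp⟩, hs, rfl⟩
  | succ n ih =>
    obtain ⟨x, hx, hx', hxs⟩ := ih fun i => hω (i + 1)
    obtain ⟨z, hz, rfl⟩ := (h.onto _ (hω 0)).1 hx'
    refine ⟨z, (h.mem_cylinder_succ (hω 0)).2 ⟨hz, hx⟩, ?_, hxs⟩
    have hz' := (h.interval _ (hω 0)).1 hz
    refine ⟨lt_of_le_of_ne hz'.1 ?_, hz'.2⟩
    rintro rfl
    rw [h0] at hx'
    exact lt_irrefl _ hx'.1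

/-- Inverse branches of the form `s ↦ (p + p' s) / (q + q' s)` with `0 ≤ q' ≤ q` have distortion
bounded by an absolute constant, so that the relative lengths of cylinders inside a cylinder of
generation `n` are comparable to lengths of cylinders. In the hypothesis `D` stands for the
absolute value of the determinant of the branch. -/
theorem IsFullShiftMap.cylindersShrink {f : ℝ → ℝ} {P : Set (Set ℝ)} (h : IsFullShiftMap f P)
    (h0 : f 0 = 0) {g : ℕ → ℝ} (hg : Tendsto g atTop (𝓝 0))
    (hM : ∀ ω : ℕ → Set ℝ, (∀ i, ω i ∈ P) → ∀ n, ∃ q q' D : ℝ, 0 < q ∧ 0 ≤ q' ∧ q' ≤ q ∧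
      0 < D ∧ (1 ≤ n → D / q ^ 2 ≤ g n) ∧ ∀ x ∈ cylinder f ω n, ∀ y ∈ cylinder f ω n,
        |x - y| * ((q + q' * f^[n] x) * (q + q' * f^[n] y)) = D * |f^[n] x - f^[n] y|) :
    CylindersShrink f P := by
  refine ⟨fun m => 8 * g m, by simpa using hg.const_mul 8, fun ω hω n m hn hm => ?_⟩
  have hupper : ∀ {ω : ℕ → Set ℝ} {n : ℕ} {q q' D x y : ℝ}, 0 < q → 0 ≤ q' →
      0 ≤ f^[n] x → 0 ≤ f^[n] y →
      |x - y| * ((q + q' * f^[n] x) * (q + q' * f^[n] y)) = D * |f^[n] x - f^[n] y| →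
      |x - y| * q ^ 2 ≤ D * |f^[n] x - f^[n] y| := by
    intro ω n q q' D x y hq hq' hx hy heq
    rw [← heq, pow_two]
    gcongr
    · nlinarith [mul_nonneg hq' hx]
    · nlinarith [mul_nonneg hq' hy]
  obtain ⟨q, q', D, hq, hq', hqq, hD, -, heq⟩ := hM ω hω n
  have hdiam : ∀ s ∈ cylinder f (fun i => ω (n + i)) m, ∀ t ∈ cylinder f (fun i => ω (n + i)) m,
      |s - t| ≤ g m := by
    intro s hs t ht
    obtain ⟨r, r', E, hr, hr', hrr, hE, hEg, heq'⟩ := hM (fun i => ω (n + i)) (fun i => hω _) m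
    have hmem : ∀ u ∈ cylinder f (fun i => ω (n + i)) m, f^[m] u ∈ Ico (0 : ℝ) 1 := by
      intro u hu
      obtain ⟨k, rfl⟩ : ∃ k, m = k + 1 := ⟨m - 1, by omega⟩
      rw [Function.iterate_succ_apply']
      exact (h.onto _ (hω _)).2 (mem_image_of_mem f (hu.2 k k.lt_succ_self))
    have hs' := hmem s hs
    have ht' := hmem t ht
    have h1 := hupper (ω := ω) hr hr' hs'.1 ht'.1 (heq' s hs t ht)
    refine le_trans ?_ (hEg hm)
    rw [le_div_iff₀ (by positivity)]
    refine h1.trans ?_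
    have : |f^[m] s - f^[m] t| ≤ 1 := by
      rw [abs_le]; constructor <;> linarith [hs'.1, hs'.2, ht'.1, ht'.2]
    nlinarith
  have hgm : 0 ≤ g m := by
    obtain ⟨s, hs, -⟩ := h.exists_iterate_eq h0 (ω := fun i => ω (n + i)) (fun i => hω _) m
      (s := 1 / 2) (by norm_num)
    simpa using hdiam s hs s hs
  have hshift : ∀ x ∈ cylinder f ω (n + m), f^[n] x ∈ cylinder f (fun i => ω (n + i)) m := by
    intro x hx
    refine ⟨(h.interval _ (hω n)).1 (hx.2 n (by omega)), fun i hi => ?_⟩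
    rw [← Function.iterate_add_apply, Nat.add_comm i n]
    exact hx.2 (n + i) (by omega)
  have hnum : volume.real (cylinder f ω (n + m)) ≤ D * g m / q ^ 2 := by
    refine ENNReal.toReal_le_of_le_ofReal (by positivity) ((Real.volume_le_diam _).trans
      (Metric.ediam_le fun x hx y hy => ?_))
    rw [edist_dist, Real.dist_eq]
    refine ENNReal.ofReal_le_ofReal ?_
    have hx' := hshift x hx
    have hy' := hshift y hy
    have h1 := hupper (ω := ω) hq hq' hx'.1.1 hy'.1.1 (heq x (cylinder_anti f ω (by omega) hx) y
      (cylinder_anti f ω (by omega) hy))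
    rw [le_div_iff₀ (by positivity)]
    exact h1.trans (mul_le_mul_of_nonneg_left (hdiam _ hx' _ hy') hD.le)
  have hden : D / (8 * q ^ 2) ≤ volume.real (cylinder f ω n) := by
    obtain ⟨x, hx, -, hxs⟩ := h.exists_iterate_eq h0 hω n (s := 1 / 4) (by norm_num)
    obtain ⟨y, hy, -, hys⟩ := h.exists_iterate_eq h0 hω n (s := 3 / 4) (by norm_num)
    refine le_trans ?_ (abs_sub_le_volume_real (h.ordConnected_cylinder hω n)
      (cylinder_subset_Ico f ω n) hx hy)
    have h1 := heq x hx y hy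
    rw [hxs, hys, show |(1 : ℝ) / 4 - 3 / 4| = 1 / 2 by norm_num [abs_of_nonpos]] at h1
    rw [div_le_iff₀ (by positivity)]
    have h2 : (q + q' * (1 / 4)) * (q + q' * (3 / 4)) ≤ 4 * q ^ 2 := by nlinarith
    have h3 := mul_le_mul_of_nonneg_left h2 (abs_nonneg (x - y))
    linarith
  have hpos : 0 < volume.real (cylinder f ω n) := lt_of_lt_of_le (by positivity) hden
  rw [div_le_iff₀ hpos]
  refine hnum.trans ?_
  calc D * g m / q ^ 2 = 8 * g m * (D / (8 * q ^ 2)) := by field_simp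
    _ ≤ 8 * g m * volume.real (cylinder f ω n) := by gcongr

/-! ### Continuity and total length of explicit pieces -/

theorem continuousAt_of_eqOn_piece {f φ : ℝ → ℝ} {J : Set ℝ} {x : ℝ} (hx : x ∈ interior J)
    (hφ : ContinuousAt φ x) (h : EqOn f φ J) : ContinuousAt f x :=
  hφ.congr (by filter_upwards [mem_interior_iff_mem_nhds.1 hx] with z hz using (h hz).symm)

theorem tsum_volume_of_sUnion {P : Set (Set ℝ)} (hc : P.Countable) (hd : P.PairwiseDisjoint id)
    (hm : ∀ J ∈ P, MeasurableSet J) {S : Set ℝ} (hS : ⋃₀ P = S) (hvol : volume S = 1) :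
    ∑' J : P, volume (J : Set ℝ) = 1 := by
  rw [← measure_sUnion hc hd hm, hS, hvol]

/-! ### The maps `x ↦ b x mod 1` -/

theorem fract_mul_eq {b j : ℕ} (hb : 0 < b) {x : ℝ}
    (hx : x ∈ Ico ((j : ℝ) / b) (((j : ℝ) + 1) / b)) : Int.fract ((b : ℝ) * x) = b * x - j := by
  have hb' : (0 : ℝ) < b := by exact_mod_cast hb
  have h1 := (div_le_iff₀ hb').1 hx.1
  have h2 := (lt_div_iff₀ hb').1 hx.2
  have : ⌊(b : ℝ) * x⌋ = (j : ℤ) := Int.floor_eq_iff.2 ⟨by push_cast; linarith, by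
    push_cast; linarith⟩
  rw [Int.fract, this, Int.cast_natCast]

theorem mem_mulPiece_floor {b : ℕ} (hb : 0 < b) {x : ℝ} (hx : x ∈ Ico (0 : ℝ) 1) :
    ⌊(b : ℝ) * x⌋₊ < b ∧
      x ∈ Ico ((⌊(b : ℝ) * x⌋₊ : ℝ) / b) (((⌊(b : ℝ) * x⌋₊ : ℝ) + 1) / b) := by
  have hb' : (0 : ℝ) < b := by exact_mod_cast hb
  have h0 : 0 ≤ (b : ℝ) * x := mul_nonneg hb'.le hx.1
  refine ⟨?_, ?_, ?_⟩
  · rw [Nat.floor_lt h0]; nlinarith [hx.2]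
  · rw [div_le_iff₀ hb', mul_comm x]; exact Nat.floor_le h0
  · rw [lt_div_iff₀ hb', mul_comm x]; exact Nat.lt_floor_add_one _

theorem isFullShiftMap_mul {b : ℕ} (hb : 2 ≤ b) :
    IsFullShiftMap (fun x => Int.fract ((b : ℝ) * x)) (mulPieces b) := by
  have hb0 : 0 < b := by omega
  have hb' : (0 : ℝ) < b := by exact_mod_cast hb0
  have hb1 : (1 : ℝ) ≤ b := by exact_mod_cast hb0
  have hcount : (mulPieces b).Countable := by
    refine (countable_range fun j : ℕ => Ico ((j : ℝ) / b) (((j : ℝ) + 1) / b)).mono ?_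
    rintro J ⟨j, -, rfl⟩
    exact ⟨j, rfl⟩
  have hdisj : (mulPieces b).PairwiseDisjoint id := by
    rintro J ⟨j, -, rfl⟩ J' ⟨j', -, rfl⟩ hne
    refine Set.disjoint_left.2 fun x hx hx' => hne ?_
    have h1 := (fract_mul_eq hb0 hx).symm.trans (fract_mul_eq hb0 hx')
    have h2 : (j : ℝ) = j' := by linarith
    rw [h2]
  have hsub : ∀ j < b, Ico ((j : ℝ) / b) (((j : ℝ) + 1) / b) ⊆ Ico 0 1 := by
    intro j hj
    refine Ico_subset_Ico (by positivity) ?_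
    rw [div_le_one hb']
    exact_mod_cast hj
  refine ⟨hcount, hdisj, ?_, ?_, ?_, ?_, ?_⟩
  · rintro J ⟨j, hj, rfl⟩
    exact ⟨hsub j hj, _, _, by gcongr; linarith, Ioo_subset_Ico_self, Ico_subset_Icc_self⟩
  · refine tsum_volume_of_sUnion (S := Ico 0 1) hcount hdisj ?_ ?_ (by simp)
    · rintro J ⟨j, -, rfl⟩
      exact measurableSet_Ico
    · refine Subset.antisymm (sUnion_subset ?_) fun x hx => ?_
      · rintro J ⟨j, hj, rfl⟩
        exact hsub j hj
      · obtain ⟨h1, h2⟩ := mem_mulPiece_floor hb0 hx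
        exact mem_sUnion.2 ⟨_, ⟨_, h1, rfl⟩, h2⟩
  · rintro J ⟨j, -, rfl⟩
    left
    intro x hx y hy hxy
    simp only [fract_mul_eq hb0 hx, fract_mul_eq hb0 hy]
    gcongr
  · rintro J ⟨j, -, rfl⟩
    constructor
    · intro s hs
      have hmem : ((j : ℝ) + s) / b ∈ Ico ((j : ℝ) / b) (((j : ℝ) + 1) / b) :=
        ⟨by gcongr; linarith [hs.1], by gcongr; exact hs.2⟩
      refine ⟨_, hmem, ?_⟩
      simp only [fract_mul_eq hb0 hmem]
      field_simp
      ring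
    · rintro _ ⟨x, -, rfl⟩
      exact ⟨Int.fract_nonneg _, Int.fract_lt_one _⟩
  · rintro J ⟨j, -, rfl⟩ x hx y hy
    simp only [fract_mul_eq hb0 hx, fract_mul_eq hb0 hy]
    rw [sub_sub_sub_cancel_right, ← mul_sub, abs_mul, abs_of_pos hb']
    nlinarith [abs_nonneg (x - y)]

theorem admissible_mul {α : ℝ} (hα : 0 < α) (hα1 : α ≤ 1 / 2) {b : ℕ} (hb : 2 ≤ b) :
    Admissible α (fun x => Int.fract ((b : ℝ) * x)) (mulPieces b) := by
  have hb0 : 0 < b := by omega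
  have hb' : (0 : ℝ) < b := by exact_mod_cast hb0
  have h := isFullShiftMap_mul hb
  refine ⟨h, h.canEnterCylinders ?_ ?_ hα hα1, ?_⟩
  · rintro J ⟨j, -, rfl⟩ x hx
    exact continuousAt_of_eqOn_piece (φ := fun x => b * x - j) hx (by fun_prop)
      fun z hz => fract_mul_eq hb0 hz
  · refine (countable_range fun j : ℕ => (j : ℝ) / b).mono ?_
    rintro x ⟨hx, hx'⟩
    obtain ⟨h1, h2⟩ := mem_mulPiece_floor hb0 hx
    refine ⟨⌊(b : ℝ) * x⌋₊, ?_⟩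
    by_contra hne
    refine hx' (mem_iUnion₂.2 ⟨_, ⟨_, h1, rfl⟩, ?_⟩)
    rw [interior_Ico]
    exact ⟨lt_of_le_of_ne h2.1 hne, h2.2⟩
  · have hlim : Tendsto (fun n : ℕ => ((b : ℝ)⁻¹) ^ n) atTop (𝓝 0) :=
      tendsto_pow_atTop_nhds_zero_of_lt_one (by positivity)
        (inv_lt_one_of_one_lt₀ (by exact_mod_cast hb))
    refine h.cylindersShrink (by simp) hlim fun ω hω n => ⟨1, 0, ((b : ℝ)⁻¹) ^ n, one_pos, le_rfl,
      zero_le_one, by positivity, fun _ => by simp, fun x hx y hy => ?_⟩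
    simp only [zero_mul, add_zero, mul_one]
    induction n with
    | zero => simp
    | succ n ih =>
      rw [ih (cylinder_anti _ _ n.le_succ hx) (cylinder_anti _ _ n.le_succ hy)]
      obtain ⟨j, -, hj⟩ := hω n
      have hxn := hx.2 n n.lt_succ_self
      have hyn := hy.2 n n.lt_succ_self
      rw [hj] at hxn hyn
      rw [Function.iterate_succ_apply', Function.iterate_succ_apply', fract_mul_eq hb0 hxn,
        fract_mul_eq hb0 hyn, sub_sub_sub_cancel_right, ← mul_sub, abs_mul, abs_of_pos hb', pow_succ]
      field_simp

/-! ### The Gauss map -/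

theorem fract_one_div_eq {n : ℕ} (hn : 1 ≤ n) {x : ℝ}
    (hx : x ∈ Ioc (1 / ((n : ℝ) + 1)) (1 / (n : ℝ))) : Int.fract (1 / x) = 1 / x - n := by
  have hn' : (0 : ℝ) < n := by exact_mod_cast hn
  have hx0 : 0 < x := lt_trans (by positivity) hx.1
  have h1 : (n : ℝ) ≤ 1 / x := (le_one_div hx0 hn').1 hx.2
  have h2 : 1 / x < n + 1 := (one_div_lt (by positivity) hx0).1 hx.1
  have : ⌊1 / x⌋ = (n : ℤ) := Int.floor_eq_iff.2 ⟨by push_cast; exact h1, by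
    push_cast; exact h2⟩
  rw [Int.fract, this, Int.cast_natCast]

theorem mem_gaussPiece_floor {x : ℝ} (hx : x ∈ Ioo (0 : ℝ) 1) :
    1 ≤ ⌊1 / x⌋₊ ∧ x ∈ Ioc (1 / ((⌊1 / x⌋₊ : ℝ) + 1)) (1 / (⌊1 / x⌋₊ : ℝ)) := by
  have h1 : 1 ≤ 1 / x := by rw [le_div_iff₀ hx.1]; linarith [hx.2]
  have hn : 1 ≤ ⌊1 / x⌋₊ := Nat.one_le_floor_iff _ |>.2 h1
  have hn' : (0 : ℝ) < ⌊1 / x⌋₊ := by exact_mod_cast hn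
  refine ⟨hn, ?_, ?_⟩
  · rw [one_div_lt (by positivity) hx.1]; exact Nat.lt_floor_add_one _
  · rw [le_one_div hx.1 hn']; exact Nat.floor_le (by linarith)

theorem pos_of_mem_gaussPiece {n : ℕ} {x : ℝ}
    (hx : x ∈ Ioc (1 / ((n : ℝ) + 1)) (1 / (n : ℝ))) : 0 < x :=
  lt_trans (by positivity) hx.1

theorem abs_one_div_sub_one_div {x y : ℝ} (hx : 0 < x) (hy : 0 < y) (c : ℝ) :
    |1 / x - c - (1 / y - c)| = |x - y| / (x * y) := by
  rw [sub_sub_sub_cancel_right, abs_sub_comm x y, ← abs_of_pos (mul_pos hx hy), ← abs_div]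
  congr 1
  field_simp

theorem isFullShiftMap_gauss : IsFullShiftMap (fun x => Int.fract (1 / x)) gaussPieces := by
  have hcount : gaussPieces.Countable := by
    refine (countable_range fun n : ℕ =>
      Ioc (1 / ((n : ℝ) + 1)) (1 / (n : ℝ)) ∩ Ico 0 1).mono ?_
    rintro J ⟨n, -, rfl⟩
    exact ⟨n, rfl⟩
  have hdisj : gaussPieces.PairwiseDisjoint id := by
    rintro J ⟨n, hn, rfl⟩ J' ⟨n', hn', rfl⟩ hne
    refine Set.disjoint_left.2 fun x hx hx' => hne ?_
    have h1 := (fract_one_div_eq hn hx.1).symm.trans (fract_one_div_eq hn' hx'.1)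
    have h2 : (n : ℝ) = n' := by linarith
    rw [h2]
  refine ⟨hcount, hdisj, ?_, ?_, ?_, ?_, ?_⟩
  · rintro J ⟨n, hn, rfl⟩
    have hn' : (1 : ℝ) ≤ n := by exact_mod_cast hn
    refine ⟨inter_subset_right, 1 / ((n : ℝ) + 1), 1 / n, ?_, fun x hx => ⟨Ioo_subset_Ioc_self hx,
      (pos_of_mem_gaussPiece (Ioo_subset_Ioc_self hx)).le, hx.2.trans_le ?_⟩,
      inter_subset_left.trans Ioc_subset_Icc_self⟩
    · exact one_div_lt_one_div_of_lt (by linarith) (by linarith)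
    · rw [div_le_one (by linarith)]; exact hn'
  · refine tsum_volume_of_sUnion (S := Ioo 0 1) hcount hdisj ?_ ?_ (by simp)
    · rintro J ⟨n, -, rfl⟩
      exact measurableSet_Ioc.inter measurableSet_Ico
    · refine Subset.antisymm (sUnion_subset ?_) fun x hx => ?_
      · rintro J ⟨n, hn, rfl⟩ x hx
        exact ⟨pos_of_mem_gaussPiece hx.1, hx.2.2⟩
      · obtain ⟨h1, h2⟩ := mem_gaussPiece_floor hx
        exact mem_sUnion.2 ⟨_, ⟨_, h1, rfl⟩, h2, Ioo_subset_Ico_self hx⟩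
  · rintro J ⟨n, hn, rfl⟩
    right
    intro x hx y hy hxy
    simp only [fract_one_div_eq hn hx.1, fract_one_div_eq hn hy.1]
    have := one_div_le_one_div_of_le (pos_of_mem_gaussPiece hx.1) hxy
    linarith
  · rintro J ⟨n, hn, rfl⟩
    have hn' : (1 : ℝ) ≤ n := by exact_mod_cast hn
    constructor
    · intro s hs
      have hmem : 1 / ((n : ℝ) + s) ∈ Ioc (1 / ((n : ℝ) + 1)) (1 / (n : ℝ)) :=
        ⟨one_div_lt_one_div_of_lt (by linarith [hs.1]) (by linarith [hs.2]),
          one_div_le_one_div_of_le (by linarith) (by linarith [hs.1])⟩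
      refine ⟨_, ⟨hmem, (pos_of_mem_gaussPiece hmem).le, ?_⟩, ?_⟩
      · rw [div_lt_one (by linarith [hs.1])]; linarith [hs.1]
      · change Int.fract (1 / (1 / ((n : ℝ) + s))) = s
        rw [fract_one_div_eq hn hmem, one_div_one_div, add_sub_cancel_left]
    · rintro _ ⟨x, -, rfl⟩
      exact ⟨Int.fract_nonneg _, Int.fract_lt_one _⟩
  · rintro J ⟨n, hn, rfl⟩ x hx y hy
    simp only [fract_one_div_eq hn hx.1, fract_one_div_eq hn hy.1]
    have hx0 := pos_of_mem_gaussPiece hx.1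
    have hy0 := pos_of_mem_gaussPiece hy.1
    rw [abs_one_div_sub_one_div hx0 hy0, le_div_iff₀ (mul_pos hx0 hy0)]
    have : x * y ≤ 1 := by nlinarith [hx.2.2, hy.2.2]
    nlinarith [abs_nonneg (x - y)]

/-- The denominators `q` and `q'` of consecutive convergents describe the branches of the iterates
of the Gauss map. -/
theorem gauss_branch {ω : ℕ → Set ℝ} (hω : ∀ i, ω i ∈ gaussPieces) (n : ℕ) :
    ∃ q q' : ℝ, 1 ≤ q ∧ (n : ℝ) ≤ q ∧ 0 ≤ q' ∧ (1 ≤ n → 1 ≤ q') ∧ q' ≤ q ∧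
      ∀ x ∈ cylinder (fun x => Int.fract (1 / x)) ω n,
      ∀ y ∈ cylinder (fun x => Int.fract (1 / x)) ω n,
        |x - y| * ((q + q' * (fun x => Int.fract (1 / x))^[n] x) *
          (q + q' * (fun x => Int.fract (1 / x))^[n] y)) =
          |(fun x => Int.fract (1 / x))^[n] x - (fun x => Int.fract (1 / x))^[n] y| := by
  induction n with
  | zero => exact ⟨1, 0, by simp⟩
  | succ n ih =>
    obtain ⟨q, q', hq, hnq, hq', hn, hqq, heq⟩ := ih
    obtain ⟨a, ha, hJ⟩ := hω n
    have ha' : (1 : ℝ) ≤ a := by exact_mod_cast ha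
    have hqa : q ≤ q * a := by nlinarith
    refine ⟨q * a + q', q, by linarith, ?_, by linarith, fun _ => hq, by linarith,
      fun x hx y hy => ?_⟩
    · push_cast
      rcases Nat.eq_zero_or_pos n with rfl | hn0
      · simp only [Nat.cast_zero]; linarith
      · linarith [hn hn0]
    · have hxn := hx.2 n n.lt_succ_self
      have hyn := hy.2 n n.lt_succ_self
      have h := heq x (cylinder_anti _ _ n.le_succ hx) y (cylinder_anti _ _ n.le_succ hy)
      rw [hJ] at hxn hyn
      rw [Function.iterate_succ_apply', Function.iterate_succ_apply', fract_one_div_eq ha hxn.1,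
        fract_one_div_eq ha hyn.1]
      generalize (fun x : ℝ => Int.fract (1 / x))^[n] x = s at *
      generalize (fun x : ℝ => Int.fract (1 / x))^[n] y = t at *
      have hs := pos_of_mem_gaussPiece hxn.1
      have ht := pos_of_mem_gaussPiece hyn.1
      rw [abs_one_div_sub_one_div hs ht, ← h]
      field_simp
      ring

theorem admissible_gauss {α : ℝ} (hα : 0 < α) (hα1 : α ≤ 1 / 2) :
    Admissible α (fun x => Int.fract (1 / x)) gaussPieces := by
  have h := isFullShiftMap_gauss
  refine ⟨h, h.canEnterCylinders ?_ ?_ hα hα1, ?_⟩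
  · rintro J ⟨n, hn, rfl⟩ x hx
    have hx0 := pos_of_mem_gaussPiece (interior_subset hx).1
    exact continuousAt_of_eqOn_piece (φ := fun x => 1 / x - n) hx
      ((continuousAt_const.div continuousAt_id hx0.ne').sub continuousAt_const)
      fun z hz => fract_one_div_eq hn hz.1
  · refine (countable_range fun n : ℕ => 1 / (n : ℝ)).mono ?_
    rintro x ⟨hx, hx'⟩
    rcases eq_or_lt_of_le hx.1 with rfl | hx0
    · exact ⟨0, by simp⟩
    obtain ⟨h1, h2⟩ := mem_gaussPiece_floor ⟨hx0, hx.2⟩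
    refine ⟨⌊1 / x⌋₊, ?_⟩
    by_contra hne
    refine hx' (mem_iUnion₂.2 ⟨_, ⟨_, h1, rfl⟩, ?_⟩)
    rw [interior_inter, interior_Ioc, interior_Ico]
    exact ⟨⟨h2.1, lt_of_le_of_ne h2.2 (Ne.symm hne)⟩, hx0, hx.2⟩
  · refine h.cylindersShrink (by simp) tendsto_one_div_atTop_nhds_zero_nat fun ω hω n => ?_
    obtain ⟨q, q', hq, hnq, hq', -, hqq, heq⟩ := gauss_branch hω n
    refine ⟨q, q', 1, by linarith, hq', hqq, one_pos, fun hn => ?_, fun x hx y hy => ?_⟩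
    · have hn' : (0 : ℝ) < n := by exact_mod_cast hn
      apply one_div_le_one_div_of_le hn'
      nlinarith
    · rw [one_mul]
      exact heq x hx y hy

end FullShift

theorem mainTheorem2 :
    (∀ (α₀ : ℝ), 0 < α₀ → α₀ < 1 →
      ∀ (f : ℕ → ℝ → ℝ) (P : ℕ → Set (Set ℝ)),
        (∀ i, FullShift.Admissible α₀ (f i) (P i)) →
      ∀ (x : ℕ → ℝ), (∀ i, FullShift.HasExpansion (f i) (P i) (x i)) →
        dimH (⋂ i, FullShift.symbolicG (f i) (P i) (x i)) = 1 ∧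
        ((∀ i, FullShift.LocallyFiniteAt (f i) (P i) (x i)) →
          dimH (⋂ i, FullShift.G (f i) (P i) (x i)) = 1)) ∧
    (∀ (α₀ : ℝ), 0 < α₀ → α₀ ≤ 1 / 2 →
      (∀ b : ℕ, 2 ≤ b →
        FullShift.Admissible α₀ (fun x => Int.fract ((b : ℝ) * x)) (FullShift.mulPieces b)) ∧
      FullShift.Admissible α₀ (fun x => Int.fract (1 / x)) FullShift.gaussPieces) := by
  refine ⟨fun α hα hα1 f P hf x hx => ⟨FullShift.dimH_iInter_symbolicG hα hα1 hf hx, fun hfin =>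
    FullShift.dimH_iInter_G hα hα1 hf (fun i => ?_) hfin⟩, fun α hα hα1 =>
    ⟨fun b hb => FullShift.admissible_mul hα hα1 hb, FullShift.admissible_gauss hα hα1⟩⟩
  obtain ⟨ω, hω⟩ := hx i
  exact hω.1
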